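/- For a finite set $P$ of points in the plane in general position (no three on a common line), a *5-hole* of $P$ is a convex pentagon whose vertices belong to $P$ and whose interior contains no point of $P$; let $H_5(P)$ be the number of 5-holes of $P$. The *first layer* $\ell_1$ of $P$ is the set of points of $P$ on the boundary of the convex hull of $P$; for $k\ge 1$, as long as $P\setminus(\ell_1\cup\dots\cup\ell_k)$ is nonempty, the layer $\ell_{k+1}$ is the first layer of that set. Let $L(P)$ be the number of layers obtained before $P$ is exhausted. **Theorem.** There is an absolute constant $c>0$ such that every nonempty finite set $P$ of $n$ points in general position in the plane satisfies $$H_5(P)\ \ge\ c\,\frac{n^2}{L(P)}-\frac1c .$$ Moreover, there is an absolute constant $c>0$ such that every such $P$, with first layer $\ell_1$, satisfies $$H_5(P)\ \ge\ c\,|\ell_1|\,n-\frac1c .$$ (That is, $P$ determines $\Omega(n^2/L(P))$ and $\Omega(|\ell_1|\,n)$ 5-holes.) -/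

import Mathlib

/-- The Euclidean plane. -/
abbrev Plane : Type := EuclideanSpace ℝ (Fin 2)

/-- No three distinct points of `P` lie on a common line. -/
def GeneralPosition (P : Finset Plane) : Prop :=
  ∀ a ∈ P, ∀ b ∈ P, ∀ c ∈ P, a ≠ b → a ≠ c → b ≠ c → ¬ Collinear ℝ {a, b, c}

/-- `H` is (the vertex set of) a `k`-hole of `P`: its elements are `k` points of `P`, they are
the vertices of a convex `k`-gon, and no point of `P` lies in the interior of that (solid)
polygon. A convex polygon is determined by its vertex set. -/
structure IsHole (P : Finset Plane) (k : ℕ) (H : Finset Plane) : Prop where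
  subset : H ⊆ P
  card_eq : H.card = k
  convexIndependent : ConvexIndependent ℝ ((↑) : ↥(H : Set Plane) → Plane)
  empty : ∀ p ∈ P, p ∉ interior (convexHull ℝ (H : Set Plane))

open scoped Classical in
/-- The `k`-holes of `P`. -/
noncomputable def holes (P : Finset Plane) (k : ℕ) : Finset (Finset Plane) :=
  {H ∈ P.powerset | IsHole P k H}

open scoped Classical in
/-- The first layer of `P`: the points of `P` on the boundary of its convex hull. -/
noncomputable def firstLayer (P : Finset Plane) : Finset Plane :=
  {p ∈ P | p ∈ frontier (convexHull ℝ (P : Set Plane))}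

open scoped Classical in
/-- `afterLayers P k` is what is left of `P` after its first `k` layers have been removed; the
`(k + 1)`-th layer of `P` is `firstLayer (afterLayers P k)`. -/
noncomputable def afterLayers (P : Finset Plane) : ℕ → Finset Plane
  | 0 => P
  | k + 1 => afterLayers P k \ firstLayer (afterLayers P k)

theorem firstLayer_nonempty {P : Finset Plane} (hP : P.Nonempty) : (firstLayer P).Nonempty := by
  have hc : IsCompact (convexHull ℝ (P : Set Plane)) := P.finite_toSet.isCompact_convexHull ℝ
  obtain ⟨x, hx⟩ := hc.extremePoints_nonempty (hP.to_set.convexHull)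
  refine ⟨x, ?_⟩
  have hxP : x ∈ P := by exact_mod_cast extremePoints_convexHull_subset hx
  simp only [firstLayer, Finset.mem_filter]
  refine ⟨hxP, subset_closure hx.1, fun hi => ?_⟩
  exact Set.disjoint_left.1 (disjoint_interior_extremePoints _) hi hx

theorem exists_afterLayers_eq_empty (P : Finset Plane) : ∃ k, afterLayers P k = ∅ := by
  have key : ∀ k, (afterLayers P k).card ≤ P.card - k := by
    intro k
    induction k with
    | zero => simp [afterLayers]
    | succ k ih =>
      classical
      rcases (afterLayers P k).eq_empty_or_nonempty with h | h
      · simp [afterLayers, h]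
      · have h1 : (afterLayers P (k + 1)).card < (afterLayers P k).card := by
          apply Finset.card_lt_card
          rw [afterLayers]
          exact Finset.sdiff_ssubset (Finset.filter_subset _ _) (firstLayer_nonempty h)
        omega
  exact ⟨P.card, Finset.card_eq_zero.1 (by have := key P.card; omega)⟩

open scoped Classical in
/-- The number of layers `L(P)`: the number of steps after which the layers exhaust `P`. -/
noncomputable def numLayers (P : Finset Plane) : ℕ :=
  Nat.find (exists_afterLayers_eq_empty P)

/-! The heart is the bound in terms of |ℓ₁|·n. A hull vertex p sees the other points in a linear
angular order, which is cut into disjoint windows of nine consecutive points. Each window yields a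
5-hole H through one of its points from which p can almost be recovered (`IsWindow.exists_hole`):
either p is a vertex of H, or H contains a pair that is supported with respect to p.

Such an H exists because of a finite fact on orientations (`exists_obstruction`). Since sign systems
violating the signotope axiom do not occur, nine sorted points contain either an empty convex
pentagon having two neighbours of the order among its vertices, or a segment visible from p with
points on its p-side both before and after it. In the visible case, suitable points on the two sides
complete p and the segment to a 5-hole (`exists_hole_of_visible`). In the pentagon case, nothing of
P lies between p and the neighbouring pair; if the pair is not supported, it is itself such a
visible segment.

An ordered pair is supported in a given sense from at most one point (`SupportedBefore.unique`,
`SupportedAfter.unique`). Hence H, a window point of H, a second vertex of H and one of three tags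
determine p and the window, so each 5-hole is charged at most 5·5·3 = 75 times
(`card_firstLayer_mul_le`).

For the bound with L(P), this is applied after some layers have been peeled off: peeling creates no
new holes (`holes_afterLayers_subset`), and averaging the telescoping sum of squared sizes finds a
good moment to stop (`exists_large_layer`). -/

/-! ### Orientations, half-planes and a criterion for 5-holes -/

/-- Twice the signed area of the triangle `a b c`; it is positive when the triangle is traversed
counterclockwise. -/
def turn (a b c : Plane) : ℝ :=
  (b 0 - a 0) * (c 1 - a 1) - (b 1 - a 1) * (c 0 - a 0)

theorem turn_rotate (a b c : Plane) : turn b c a = turn a b c := by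
  unfold turn; ring

theorem turn_swap (a b c : Plane) : turn a c b = -turn a b c := by
  unfold turn; ring

theorem turn_swap' (a b c : Plane) : turn b a c = -turn a b c := by
  unfold turn; ring

theorem turn_self_left (a b : Plane) : turn a a b = 0 := by
  unfold turn; ring

theorem turn_self_right (a b : Plane) : turn a b b = 0 := by
  unfold turn; ring

theorem turn_self_outer (a b : Plane) : turn a b a = 0 := by
  unfold turn; ring

theorem collinear_of_turn_eq_zero {a b c : Plane} (hab : a ≠ b) (h : turn a b c = 0) :
    Collinear ℝ {a, b, c} := by
  rw [collinear_iff_of_mem (p₀ := a) (by simp)]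
  refine ⟨b - a, ?_⟩
  have hne : b 0 - a 0 ≠ 0 ∨ b 1 - a 1 ≠ 0 := by
    by_contra! hc
    apply hab
    ext i
    fin_cases i
    · simpa using (sub_eq_zero.1 hc.1).symm
    · simpa using (sub_eq_zero.1 hc.2).symm
  unfold turn at h
  have hc : ∃ r : ℝ, c = r • (b - a) +ᵥ a := by
    rcases hne with h0 | h1
    · refine ⟨(c 0 - a 0) / (b 0 - a 0), ?_⟩
      ext i
      fin_cases i
      · simp; field_simp; ring
      · simp; field_simp; linarith
    · refine ⟨(c 1 - a 1) / (b 1 - a 1), ?_⟩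
      ext i
      fin_cases i
      · simp; field_simp; linarith
      · simp; field_simp; ring
  intro x hx
  simp only [Set.mem_insert_iff, Set.mem_singleton_iff] at hx
  rcases hx with rfl | rfl | rfl
  · exact ⟨0, by simp⟩
  · exact ⟨1, by simp⟩
  · exact hc

theorem GeneralPosition.turn_ne_zero {P : Finset Plane} (hP : GeneralPosition P) {a b c : Plane}
    (ha : a ∈ P) (hb : b ∈ P) (hc : c ∈ P) (hab : a ≠ b) (hac : a ≠ c) (hbc : b ≠ c) :
    turn a b c ≠ 0 :=
  fun h => hP a ha b hb c hc hab hac hbc (collinear_of_turn_eq_zero hab h)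

theorem GeneralPosition.mono {P Q : Finset Plane} (hP : GeneralPosition P) (h : Q ⊆ P) :
    GeneralPosition Q :=
  fun a ha b hb c hc => hP a (h ha) b (h hb) c (h hc)

theorem turn_combo (u v x y : Plane) {s t : ℝ} (hst : s + t = 1) :
    turn u v (s • x + t • y) = s * turn u v x + t * turn u v y := by
  have : s = 1 - t := by linarith
  subst this
  simp [turn]
  ring

theorem turn_nonneg_of_mem_convexHull {S : Set Plane} {u v z : Plane}
    (hS : ∀ x ∈ S, 0 ≤ turn u v x) (hz : z ∈ convexHull ℝ S) : 0 ≤ turn u v z := by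
  have hc : Convex ℝ {x : Plane | 0 ≤ turn u v x} := by
    intro x hx y hy s t hs ht hst
    simp only [Set.mem_ofPred_eq] at *
    rw [turn_combo u v x y hst]
    positivity
  exact convexHull_min (t := {x : Plane | 0 ≤ turn u v x}) hS hc hz

/-- The function `turn u v` is affine and, because of `w`, not constant on the line joining `z` to
`w`. If it vanished at the interior point `z`, it would take both signs on that line near `z`. -/
theorem turn_pos_of_mem_interior {S : Set Plane} {u v w z : Plane} (hw : turn u v w ≠ 0)
    (hS : ∀ x ∈ S, 0 ≤ turn u v x) (hz : z ∈ interior (convexHull ℝ S)) : 0 < turn u v z := by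
  rcases (turn_nonneg_of_mem_convexHull hS (interior_subset hz)).lt_or_eq with h | h
  · exact h
  exfalso
  have hline : ∀ᶠ s in nhds (0 : ℝ), (1 - s) • z + s • w ∈ interior (convexHull ℝ S) := by
    have hcont : Continuous fun s : ℝ => (1 - s) • z + s • w := by fun_prop
    refine hcont.continuousAt.eventually_mem ?_
    simpa using isOpen_interior.mem_nhds hz
  have hnn : ∀ᶠ s in nhds (0 : ℝ), 0 ≤ s * turn u v w := by
    filter_upwards [hline] with s hs
    have := turn_nonneg_of_mem_convexHull hS (interior_subset hs)
    rw [turn_combo u v z w (by ring), ← h] at this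
    simpa using this
  obtain ⟨ε, hε, hball⟩ := Metric.eventually_nhds_iff.1 hnn
  have h1 := hball (y := ε / 2) (by simp [abs_of_pos hε]; linarith)
  have h2 := hball (y := -(ε / 2)) (by simp [abs_of_pos hε]; linarith)
  apply hw
  nlinarith

open scoped Classical in
/-- Five points in counterclockwise convex position around a region free of points of `P` form a
`5`-hole. -/
theorem mem_holes_of_turn_pos {P : Finset Plane} {a b c d e : Plane}
    (ha : a ∈ P) (hb : b ∈ P) (hc : c ∈ P) (hd : d ∈ P) (he : e ∈ P)
    (abc : 0 < turn a b c) (abd : 0 < turn a b d) (abe : 0 < turn a b e)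
    (acd : 0 < turn a c d) (ace : 0 < turn a c e) (ade : 0 < turn a d e)
    (bcd : 0 < turn b c d) (bce : 0 < turn b c e) (bde : 0 < turn b d e)
    (cde : 0 < turn c d e)
    (hempty : ∀ z ∈ P, z ∉ interior (convexHull ℝ ({a, b, c, d, e} : Set Plane))) :
    ({a, b, c, d, e} : Finset Plane) ∈ holes P 5 := by
  have ne1 : ∀ {x y z : Plane}, 0 < turn x y z → x ≠ y := by
    rintro x y z h rfl; simp [turn_self_left] at h
  have ne2 : ∀ {x y z : Plane}, 0 < turn x y z → y ≠ z := by
    rintro x y z h rfl; simp [turn_self_right] at h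
  have ne3 : ∀ {x y z : Plane}, 0 < turn x y z → x ≠ z := by
    rintro x y z h rfl; simp [turn_self_outer] at h
  have hset : (({a, b, c, d, e} : Finset Plane) : Set Plane) = {a, b, c, d, e} := by
    ext; simp
  simp only [holes, Finset.mem_filter, Finset.mem_powerset]
  have hsub : ({a, b, c, d, e} : Finset Plane) ⊆ P := by
    intro x hx
    simp only [Finset.mem_insert, Finset.mem_singleton] at hx
    rcases hx with rfl | rfl | rfl | rfl | rfl <;> assumption
  refine ⟨hsub, hsub, ?_, ?_, ?_⟩
  · rw [Finset.card_insert_of_notMem, Finset.card_insert_of_notMem, Finset.card_insert_of_notMem,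
      Finset.card_pair (ne2 cde)]
    · simp [ne1 cde, ne3 cde]
    · simp [ne1 bcd, ne3 bcd, ne3 bce]
    · simp [ne1 abc, ne1 acd, ne1 ade, ne3 abe]
  · rw [convexIndependent_set_iff_notMem_convexHull_sdiff, hset]
    have key : ∀ u v x : Plane, turn u v x < 0 →
        (∀ y ∈ ({a, b, c, d, e} : Set Plane) \ {x}, 0 ≤ turn u v y) →
        x ∉ convexHull ℝ (({a, b, c, d, e} : Set Plane) \ {x}) := by
      intro u v x hx hy hmem
      exact absurd (turn_nonneg_of_mem_convexHull hy hmem) (not_le.2 hx)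
    have r : ∀ x y z : Plane, 0 < turn x y z → 0 < turn z x y := by
      intro x y z h; rw [← turn_rotate z x y]; exact h
    have r' : ∀ x y z : Plane, 0 < turn x y z → 0 < turn y z x := by
      intro x y z h; rw [turn_rotate x y z]; exact h
    have s : ∀ x y z : Plane, 0 < turn x y z → turn x z y < 0 := by
      intro x y z h; rw [turn_swap]; linarith
    intro x hx
    simp only [Set.mem_insert_iff, Set.mem_singleton_iff] at hx
    have fin : ∀ u v x : Plane, x ∈ ({a, b, c, d, e} : Set Plane) →
        (a = x ∨ 0 ≤ turn u v a) → (b = x ∨ 0 ≤ turn u v b) → (c = x ∨ 0 ≤ turn u v c) →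
        (d = x ∨ 0 ≤ turn u v d) → (e = x ∨ 0 ≤ turn u v e) →
        ∀ y ∈ ({a, b, c, d, e} : Set Plane) \ {x}, 0 ≤ turn u v y := by
      rintro u v x - h1 h2 h3 h4 h5 y ⟨hy, hyx⟩
      simp only [Set.mem_insert_iff, Set.mem_singleton_iff] at hy hyx
      rcases hy with rfl | rfl | rfl | rfl | rfl
      · exact h1.resolve_left hyx
      · exact h2.resolve_left hyx
      · exact h3.resolve_left hyx
      · exact h4.resolve_left hyx
      · exact h5.resolve_left hyx
    -- Each vertex is cut off from the other four by the diagonal joining its two neighbours.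
    rcases hx with rfl | rfl | rfl | rfl | rfl
    · refine key e b _ ?_ (fin _ _ _ (by simp) (Or.inl rfl) ?_ ?_ ?_ ?_)
      · have := s _ _ _ (r _ _ _ abe); exact this
      · right; rw [turn_self_right]
      · right; exact (r _ _ _ bce).le
      · right; exact (r _ _ _ bde).le
      · right; rw [turn_self_outer]
    · refine key a c _ (s _ _ _ abc) (fin _ _ _ (by simp) ?_ (Or.inl rfl) ?_ ?_ ?_)
      · right; rw [turn_self_outer]
      · right; rw [turn_self_right]
      · right; exact acd.le
      · right; exact ace.le
    · refine key b d _ (s _ _ _ bcd) (fin _ _ _ (by simp) ?_ ?_ (Or.inl rfl) ?_ ?_)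
      · right; exact (r' _ _ _ abd).le
      · right; rw [turn_self_outer]
      · right; rw [turn_self_right]
      · right; exact bde.le
    · refine key c e _ (s _ _ _ cde) (fin _ _ _ (by simp) ?_ ?_ ?_ (Or.inl rfl) ?_)
      · right; exact (r' _ _ _ ace).le
      · right; exact (r' _ _ _ bce).le
      · right; rw [turn_self_outer]
      · right; rw [turn_self_right]
    · refine key d a _ ?_ (fin _ _ _ (by simp) ?_ ?_ ?_ ?_ (Or.inl rfl))
      · have := s _ _ _ (r' _ _ _ ade); exact this
      · right; rw [turn_self_right]
      · right; exact (r _ _ _ abd).le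
      · right; exact (r _ _ _ acd).le
      · right; rw [turn_self_outer]
  · rw [hset]; exact hempty

/-! ### A finite certificate for nine sorted points -/

/-- The possible contradictions met when trying to describe the orientations of nine points sorted
around an apex: a violation of the signotope axiom by four points, an edge that is visible from the
apex and has points below it on either side, or an empty convex pentagon with an edge joining
neighbours, whose inner vertices are marked `true` when they lie on its lower chain. -/
inductive Obstruction
  | signotope (a b c d : ℕ)
  | visible (k i j l : ℕ)
  | hole (low₁ low₂ low₃ : Bool) (a b c d e : ℕ)

/-- A case analysis on the orientations of triples, ending in obstructions. -/
inductive CaseTree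
  | leaf (o : Obstruction)
  | split (i j k : ℕ) (t f : CaseTree)

/-- All consecutive triples of the list have orientation `s`, according to `h`. -/
def turnsAre (h : ℕ → ℕ → ℕ → Bool → Bool) (s : Bool) : List ℕ → Bool
  | u :: v :: w :: l => h u v w s && turnsAre h s (v :: w :: l)
  | _ => true

/-- The point `x` lies on the side `s` of the edge of the chain spanning it, according to `h`. -/
def isBeyond (h : ℕ → ℕ → ℕ → Bool → Bool) (s : Bool) (x : ℕ) : List ℕ → Bool
  | u :: v :: l => (Nat.blt u x && Nat.blt x v && h u x v s) || isBeyond h s x (v :: l)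
  | _ => false

/-- The chain from `a` to `e` through those of `b`, `c`, `d` that are marked. -/
def chain (sb sc sd : Bool) (a b c d e : ℕ) : List ℕ :=
  a :: (cond sb [b] [] ++ (cond sc [c] [] ++ (cond sd [d] [] ++ [e])))

/-- Whether the obstruction is present, given that `h i j k s` is the information that the triple
`i j k` has orientation `s`. -/
def Obstruction.test (h : ℕ → ℕ → ℕ → Bool → Bool) : Obstruction → Bool
  | signotope a b c d =>
    Nat.blt a b && Nat.blt b c && Nat.blt c d && Nat.blt d 9 &&
      [true, false].any fun s =>
        -- In the order abc, abd, acd, bcd the signs may change only once; these are the four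
        -- choices of three triples with alternating signs.
        (h a b c s && h a b d !s && h a c d s) || (h a b c s && h a b d !s && h b c d s) ||
        (h a b c s && h a c d !s && h b c d s) || (h a b d s && h a c d !s && h b c d s)
  | visible k i j l =>
    Nat.blt k i && Nat.blt i j && Nat.blt j l && Nat.blt l 9 && h k i j false && h i j l false &&
      (List.range j).all fun m => Nat.ble m i || h i m j false
  | hole sb sc sd a b c d e =>
    Nat.blt a b && Nat.blt b c && Nat.blt c d && Nat.blt d e && Nat.blt e 9 &&
      -- Neighbours in the angular order suffice, even when they lie on different chains and span a
      -- diagonal: the later charging only needs the sector between them to be free of points.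
      (Nat.beq b (a + 1) || Nat.beq c (b + 1) || Nat.beq d (c + 1) || Nat.beq e (d + 1)) &&
      turnsAre h true (chain sb sc sd a b c d e) &&
      turnsAre h false (chain (!sb) (!sc) (!sd) a b c d e) &&
      -- Only points strictly between `a` and `e` in the order can lie inside; each must be outside
      -- some edge of the two chains.
      (List.range e).all fun x =>
        Nat.ble x a || Nat.beq x b || Nat.beq x c || Nat.beq x d ||
          isBeyond h true x (chain sb sc sd a b c d e) ||
          isBeyond h false x (chain (!sb) (!sc) (!sd) a b c d e)

/-- The information contained in a list of known orientations. -/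
def known (ctx : List (ℕ × ℕ × ℕ × Bool)) (i j k : ℕ) (s : Bool) : Bool :=
  ctx.any fun t => Nat.beq t.1 i && Nat.beq t.2.1 j && Nat.beq t.2.2.1 k && (t.2.2.2 == s)

/-- Whether every branch of the case tree ends in an obstruction. -/
def CaseTree.check : List (ℕ × ℕ × ℕ × Bool) → CaseTree → Bool
  | ctx, leaf o => o.test (known ctx)
  | ctx, split i j k t f =>
    t.check ((i, j, k, true) :: ctx) && f.check ((i, j, k, false) :: ctx)

theorem turnsAre_mono {g h : ℕ → ℕ → ℕ → Bool → Bool}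
    (hgh : ∀ i j k s, g i j k s = true → h i j k s = true) (s : Bool) :
    ∀ l : List ℕ, turnsAre g s l = true → turnsAre h s l = true
  | [] => id
  | [_] => id
  | [_, _] => id
  | u :: v :: w :: l => by
    simp only [turnsAre, Bool.and_eq_true]
    exact And.imp (hgh _ _ _ _) (turnsAre_mono hgh s _)

theorem isBeyond_mono {g h : ℕ → ℕ → ℕ → Bool → Bool}
    (hgh : ∀ i j k s, g i j k s = true → h i j k s = true) (s : Bool) (x : ℕ) :
    ∀ l : List ℕ, isBeyond g s x l = true → isBeyond h s x l = true
  | [] => id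
  | [_] => id
  | u :: v :: l => by
    simp only [isBeyond, Bool.and_eq_true, Bool.or_eq_true]
    exact Or.imp (And.imp_right (hgh _ _ _ _)) (isBeyond_mono hgh s x _)

/-- The tests use known orientations only positively, never the absence of information. An
obstruction seen with the partial knowledge of one branch therefore persists when all orientations
are known. -/
theorem Obstruction.test_mono {g h : ℕ → ℕ → ℕ → Bool → Bool}
    (hgh : ∀ i j k s, g i j k s = true → h i j k s = true)
    (o : Obstruction) (ho : o.test g = true) : o.test h = true := by
  cases o with
  | signotope a b c d =>
    simp only [test, Bool.and_eq_true, List.any_cons, List.any_nil, Bool.or_eq_true] at ho ⊢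
    have := hgh
    grind
  | visible k i j l =>
    simp only [test, Bool.and_eq_true, List.all_eq_true, Bool.or_eq_true] at ho ⊢
    obtain ⟨⟨⟨h1, h2⟩, h3⟩, h4⟩ := ho
    exact ⟨⟨⟨h1, hgh _ _ _ _ h2⟩, hgh _ _ _ _ h3⟩, fun m hm => (h4 m hm).imp_right (hgh _ _ _ _)⟩
  | hole sb sc sd a b c d e =>
    simp only [test, Bool.and_eq_true, List.all_eq_true, Bool.or_eq_true] at ho ⊢
    obtain ⟨⟨⟨h1, h2⟩, h3⟩, h4⟩ := ho
    exact ⟨⟨⟨h1, turnsAre_mono hgh _ _ h2⟩, turnsAre_mono hgh _ _ h3⟩, fun m hm =>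
      (h4 m hm).imp (Or.imp_right (isBeyond_mono hgh _ _ _)) (isBeyond_mono hgh _ _ _)⟩

/-- If every branch of a case tree ends in an obstruction, then every system of orientations
exhibits one. -/
theorem CaseTree.exists_obstruction {X : ℕ → ℕ → ℕ → Bool} (T : CaseTree) :
    ∀ ctx : List (ℕ × ℕ × ℕ × Bool), (∀ t ∈ ctx, X t.1 t.2.1 t.2.2.1 = t.2.2.2) →
      T.check ctx = true → ∃ o : Obstruction, o.test (fun i j k s => X i j k == s) = true := by
  induction T with
  | leaf o =>
    intro ctx hctx ho
    refine ⟨o, o.test_mono (g := known ctx) ?_ ho⟩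
    intro i j k s hk
    simp only [known, List.any_eq_true, Bool.and_eq_true, beq_iff_eq] at hk ⊢
    obtain ⟨t, ht, ⟨⟨h1, h2⟩, h3⟩, h4⟩ := hk
    rw [← Nat.eq_of_beq_eq_true h1, ← Nat.eq_of_beq_eq_true h2, ← Nat.eq_of_beq_eq_true h3, ← h4]
    exact hctx t ht
  | split i j k t f iht ihf =>
    intro ctx hctx hT
    simp only [check, Bool.and_eq_true] at hT
    cases hX : X i j k with
    | true =>
      refine iht _ ?_ hT.1
      intro t ht
      rcases List.mem_cons.1 ht with rfl | ht
      · exact hX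
      · exact hctx t ht
    | false =>
      refine ihf _ ?_ hT.2
      intro t ht
      rcases List.mem_cons.1 ht with rfl | ht
      · exact hX
      · exact hctx t ht

/-- A case analysis showing that nine points sorted around an apex always exhibit an
obstruction. -/
def ninePointTree : CaseTree :=
  (.split 1 2 3 (.split 2 3 4 (.split 1 2 4 (.split 1 3 4 (.split 0 1 2 (.leaf (.hole true true
  true 0 1 2 3 4)) (.split 3 4 5 (.leaf (.hole true true true 1 2 3 4 5)) (.split 1 2 5 (.split 0
  3 4 (.split 4 5 6 (.split 4 5 7 (.split 4 5 8 (.split 3 4 6 (.leaf (.hole true true true 1 2 3 4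
  6)) (.split 2 4 5 (.leaf (.hole true true true 1 2 4 5 6)) (.split 0 2 3 (.split 0 2 4 (.split 0
  1 4 (.split 1 4 5 (.leaf (.hole true true true 0 1 4 5 6)) (.split 2 3 5 (.leaf (.hole true true
  false 1 2 3 4 5)) (.split 3 5 6 (.split 3 5 7 (.split 4 6 7 (.split 1 4 6 (.leaf (.hole true
  true true 0 1 4 6 7)) (.split 3 4 7 (.leaf (.hole true true true 1 2 3 4 7)) (.split 2 3 6
  (.leaf (.hole true true false 1 2 3 4 6)) (.split 1 3 5 (.leaf (.hole true false true 1 3 4 5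
  6)) (.split 5 6 7 (.leaf (.hole false true true 3 4 5 6 7)) (.split 2 5 6 (.split 6 7 8 (.split
  1 3 6 (.split 4 6 8 (.split 4 7 8 (.split 0 4 6 (.leaf (.hole true true true 0 4 6 7 8)) (.split
  0 1 3 (.leaf (.hole true true false 0 1 3 4 6)) (.split 3 4 8 (.leaf (.hole true true true 1 2 3
  4 8)) (.split 0 2 5 (.leaf (.hole false true false 0 1 2 3 5)) (.split 3 6 7 (.leaf (.hole false
  true true 3 4 6 7 8)) (.split 2 5 7 (.leaf (.hole false true false 2 3 5 6 7)) (.leaf (.visible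
  0 2 5 7)))))))) (.leaf (.signotope 4 6 7 8))) (.leaf (.signotope 4 6 7 8))) (.leaf (.hole true
  false true 1 2 3 5 6))) (.leaf (.visible 5 6 7 8))) (.leaf (.visible 2 5 6 7)))))))) (.leaf
  (.hole false true false 3 4 5 6 7))) (.leaf (.visible 2 3 5 7))) (.leaf (.visible 2 3 5 6)))))
  (.leaf (.hole false true true 0 1 2 3 4))) (.leaf (.signotope 0 2 3 4))) (.split 2 3 5 (.split 1
  4 5 (.split 1 4 6 (.split 5 6 7 (.leaf (.hole true true true 1 4 5 6 7)) (.split 3 5 6 (.split 6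
  7 8 (.split 2 4 6 (.split 4 6 8 (.leaf (.hole true true true 1 2 4 6 8)) (.split 4 6 7 (.leaf
  (.hole true true true 1 4 6 7 8)) (.split 5 7 8 (.leaf (.hole true false true 4 5 6 7 8))
  (.split 3 5 7 (.leaf (.hole false true false 3 4 5 6 7)) (.leaf (.visible 3 5 7 8)))))) (.leaf
  (.hole true false true 2 3 4 5 6))) (.leaf (.visible 5 6 7 8))) (.leaf (.visible 3 5 6 7))))
  (.leaf (.signotope 1 4 5 6))) (.leaf (.hole true true false 1 2 3 4 5))) (.leaf (.visible 0 2 3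
  5)))))) (.leaf (.visible 3 4 5 8))) (.leaf (.visible 3 4 5 7))) (.leaf (.visible 3 4 5 6)))
  (.leaf (.visible 0 3 4 5))) (.leaf (.visible 0 1 2 5))))) (.leaf (.signotope 1 2 3 4))) (.leaf
  (.signotope 1 2 3 4))) (.split 0 2 3 (.split 3 4 5 (.split 3 4 6 (.split 3 4 7 (.split 3 4 8
  (.split 2 4 5 (.split 4 5 6 (.split 3 5 6 (.split 1 3 4 (.leaf (.hole true true true 1 3 4 5 6))
  (.split 2 3 6 (.split 5 6 7 (.leaf (.hole true true true 3 4 5 6 7)) (.split 0 1 2 (.leaf (.hole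
  true true true 0 1 2 3 6)) (.split 2 3 5 (.leaf (.hole true true true 1 2 3 5 6)) (.split 3 6 7
  (.leaf (.hole true true true 1 2 3 6 7)) (.split 6 7 8 (.split 1 2 4 (.split 4 5 7 (.leaf (.hole
  true true false 3 4 5 6 7)) (.split 3 6 8 (.leaf (.hole true true true 1 2 3 6 8)) (.split 1 3 5
  (.split 5 7 8 (.split 3 5 7 (.leaf (.hole true false true 3 5 6 7 8)) (.split 0 1 3 (.leaf
  (.hole true true true 0 1 3 5 6)) (.split 2 4 7 (.leaf (.hole false true false 2 3 4 5 7))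
  (.split 0 2 4 (.leaf (.hole false true false 0 1 2 3 4)) (.leaf (.visible 0 2 4 7)))))) (.leaf
  (.visible 4 5 7 8))) (.leaf (.hole true false true 1 2 3 4 5))))) (.leaf (.visible 0 1 2 4)))
  (.leaf (.visible 5 6 7 8))))))) (.leaf (.hole false true true 2 3 4 5 6)))) (.leaf (.signotope 3
  4 5 6))) (.split 0 4 5 (.split 1 4 5 (.split 5 6 7 (.split 5 6 8 (.split 1 2 4 (.split 1 2 5
  (.split 1 3 5 (.split 3 5 6 (.leaf (.hole true true true 1 3 5 6 7)) (.split 6 7 8 (.split 5 7 8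
  (.split 1 5 6 (.leaf (.hole true true true 1 5 6 7 8)) (.split 3 5 7 (.leaf (.hole true true
  true 1 3 5 7 8)) (.split 2 3 6 (.leaf (.hole true true false 1 2 3 5 6)) (.split 1 3 4 (.leaf
  (.hole true true false 1 3 4 5 6)) (.split 4 6 7 (.leaf (.hole true false true 3 4 5 6 7))
  (.split 2 4 6 (.split 1 3 6 (.split 2 3 5 (.split 0 2 5 (.split 0 3 5 (.split 0 1 5 (.split 3 5
  8 (.leaf (.hole true true true 1 2 3 5 8)) (.split 0 5 6 (.leaf (.hole true true true 0 5 6 7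
  8)) (.split 3 6 7 (.leaf (.hole false true true 3 5 6 7 8)) (.split 0 1 3 (.leaf (.hole true
  true false 0 1 3 5 6)) (.split 2 4 7 (.leaf (.hole false true false 2 3 4 6 7)) (.split 0 2 4
  (.leaf (.hole false true false 0 1 2 3 4)) (.leaf (.visible 0 2 4 7)))))))) (.leaf (.hole false
  true true 0 1 2 3 5))) (.leaf (.signotope 0 2 3 5))) (.leaf (.signotope 0 2 3 5))) (.leaf (.hole
  false true false 2 3 4 5 6))) (.leaf (.hole true false true 1 2 3 4 6))) (.leaf (.visible 2 4 6
  7)))))))) (.leaf (.signotope 5 6 7 8))) (.split 4 6 7 (.split 3 5 7 (.split 0 1 3 (.leaf (.hole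
  true true true 0 1 3 5 7)) (.split 2 3 5 (.leaf (.hole true true true 1 2 3 5 7)) (.split 5 7 8
  (.leaf (.hole true true true 1 3 5 7 8)) (.split 2 4 6 (.leaf (.hole false true false 2 3 4 5
  6)) (.split 0 2 4 (.split 4 6 8 (.split 1 3 4 (.split 4 5 7 (.leaf (.hole true true true 1 3 4 5
  7)) (.leaf (.hole false true false 4 5 6 7 8))) (.leaf (.hole false true false 0 1 2 3 4)))
  (.leaf (.visible 2 4 6 8))) (.leaf (.visible 0 2 4 6))))))) (.leaf (.hole true false true 3 4 5
  6 7))) (.leaf (.visible 4 6 7 8))))) (.leaf (.hole true false true 1 2 3 4 5))) (.leaf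
  (.signotope 1 2 4 5))) (.split 0 1 2 (.split 2 4 6 (.split 0 1 3 (.split 2 3 5 (.leaf (.hole
  true true true 0 1 2 3 5)) (.split 3 5 6 (.split 0 3 5 (.leaf (.hole true true true 0 3 5 6 7))
  (.split 3 5 7 (.split 3 6 7 (.split 3 5 8 (.split 3 6 8 (.split 3 7 8 (.split 6 7 8 (.leaf
  (.hole true true true 3 5 6 7 8)) (.split 1 2 5 (.leaf (.hole true true false 0 1 2 3 5))
  (.split 2 3 7 (.leaf (.hole true true true 0 1 2 3 7)) (.split 2 3 8 (.leaf (.hole true true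
  true 0 1 2 3 8)) (.split 4 6 7 (.split 4 5 7 (.leaf (.hole false true true 2 3 4 5 7)) (.split 2
  5 6 (.leaf (.hole false true true 2 3 5 6 7)) (.split 2 5 7 (.split 1 4 6 (.leaf (.hole false
  true false 1 2 4 5 6)) (.split 5 7 8 (.leaf (.hole false true true 2 3 5 7 8)) (.split 4 6 8
  (.leaf (.hole false true false 4 5 6 7 8)) (.leaf (.visible 1 4 6 8))))) (.leaf (.hole true
  false true 2 4 5 6 7))))) (.leaf (.visible 4 6 7 8))))))) (.leaf (.hole true true false 3 5 6 7
  8))) (.leaf (.signotope 3 5 6 8))) (.leaf (.signotope 3 5 6 8))) (.leaf (.signotope 3 5 6 7)))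
  (.leaf (.signotope 3 5 6 7)))) (.leaf (.hole false true false 2 3 4 5 6)))) (.leaf (.signotope 0
  1 2 3))) (.leaf (.visible 1 2 4 6))) (.leaf (.visible 0 1 2 4)))) (.leaf (.visible 4 5 6 8)))
  (.leaf (.visible 4 5 6 7))) (.leaf (.visible 1 4 5 6))) (.leaf (.visible 0 4 5 6)))) (.split 2 3
  5 (.leaf (.signotope 2 3 4 5)) (.split 0 2 4 (.split 1 2 4 (.split 4 5 6 (.split 4 5 7 (.split 3
  5 6 (.split 1 3 4 (.leaf (.hole true true true 1 3 4 5 6)) (.split 5 6 7 (.leaf (.hole true true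
  true 3 4 5 6 7)) (.split 3 6 7 (.split 0 1 3 (.split 2 5 6 (.split 6 7 8 (.split 1 3 6 (.leaf
  (.hole true true true 0 1 3 6 7)) (.split 0 3 6 (.leaf (.hole true true true 0 3 6 7 8)) (.split
  0 3 4 (.leaf (.hole true true true 0 3 4 5 6)) (.split 4 6 7 (.leaf (.hole true true true 3 4 6
  7 8)) (.split 2 4 6 (.leaf (.hole true false true 1 2 3 4 6)) (.split 1 4 5 (.leaf (.hole false
  true true 1 3 4 5 6)) (.split 0 1 2 (.leaf (.hole true true false 0 1 2 3 4)) (.split 2 5 7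
  (.leaf (.hole false true false 2 4 5 6 7)) (.split 1 2 5 (.split 0 2 5 (.split 1 4 6 (.split 0 1
  4 (.leaf (.hole true false true 0 1 3 4 6)) (.leaf (.hole false true false 0 1 2 4 5))) (.leaf
  (.hole true false true 1 2 4 5 6))) (.leaf (.visible 0 2 5 7))) (.leaf (.visible 0 1 2
  5))))))))))) (.leaf (.visible 5 6 7 8))) (.leaf (.visible 2 5 6 7))) (.leaf (.hole false true
  false 0 1 2 3 4))) (.leaf (.hole true true false 3 4 5 6 7))))) (.leaf (.signotope 3 4 5 6)))
  (.leaf (.visible 2 4 5 7))) (.leaf (.visible 2 4 5 6))) (.leaf (.visible 1 2 4 5))) (.leaf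
  (.visible 0 2 4 5))))) (.leaf (.visible 2 3 4 8))) (.leaf (.visible 2 3 4 7))) (.leaf (.visible
  2 3 4 6))) (.leaf (.visible 2 3 4 5))) (.leaf (.visible 0 2 3 4)))) (.split 0 1 2 (.split 2 3 4
  (.split 2 3 5 (.split 2 3 6 (.split 4 5 6 (.split 3 4 5 (.leaf (.hole true true true 2 3 4 5 6))
  (.split 1 3 4 (.split 4 5 7 (.split 4 5 8 (.split 3 5 6 (.split 2 5 6 (.split 2 4 6 (.split 1 2
  4 (.leaf (.hole true true true 0 1 2 4 6)) (.split 0 1 3 (.split 0 2 4 (.split 0 2 6 (.split 2 4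
  5 (.leaf (.hole true true true 0 2 4 5 6)) (.split 4 6 7 (.leaf (.hole true true true 0 2 4 6
  7)) (.split 1 3 5 (.leaf (.hole false true false 1 2 3 4 5)) (.split 6 7 8 (.split 3 5 7 (.split
  3 5 8 (.split 2 6 7 (.leaf (.hole true true true 0 2 6 7 8)) (.split 2 4 7 (.split 3 4 6 (.split
  3 4 7 (.leaf (.hole true true false 2 3 4 6 7)) (.split 1 2 6 (.split 4 7 8 (.split 2 6 8 (.leaf
  (.hole true true true 0 1 2 6 8)) (.leaf (.hole true false true 2 4 6 7 8))) (.leaf (.hole false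
  true false 3 4 5 7 8))) (.leaf (.hole false true true 1 2 3 4 6)))) (.leaf (.hole false true
  false 3 4 5 6 7))) (.leaf (.hole true false true 2 3 4 5 7)))) (.leaf (.visible 1 3 5 8)))
  (.leaf (.visible 1 3 5 7))) (.leaf (.visible 4 6 7 8)))))) (.leaf (.signotope 0 2 4 6))) (.leaf
  (.hole true false true 0 1 2 3 4))) (.split 1 3 5 (.split 2 4 5 (.split 1 4 6 (.split 2 6 7
  (.split 5 6 7 (.leaf (.hole true true true 2 4 5 6 7)) (.split 1 2 6 (.leaf (.hole true true
  true 0 1 2 6 7)) (.split 6 7 8 (.split 3 4 6 (.leaf (.hole false true true 1 2 3 4 6)) (.split 1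
  4 5 (.leaf (.hole false true true 1 2 4 5 6)) (.split 0 2 6 (.leaf (.hole true true true 0 2 6 7
  8)) (.split 4 6 7 (.leaf (.hole true true true 2 4 6 7 8)) (.split 3 5 7 (.leaf (.hole false
  true false 3 4 5 6 7)) (.split 0 1 4 (.leaf (.hole true false true 0 1 2 4 6)) (.split 0 3 5
  (.leaf (.hole false true false 0 1 3 4 5)) (.leaf (.visible 0 3 5 7))))))))) (.leaf (.visible 5
  6 7 8))))) (.leaf (.hole true true false 2 4 5 6 7))) (.leaf (.hole true false true 1 3 4 5 6)))
  (.leaf (.hole false true false 1 2 3 4 5))) (.leaf (.visible 0 1 3 5))))) (.leaf (.hole true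
  false true 2 3 4 5 6))) (.leaf (.signotope 2 3 5 6))) (.split 3 4 6 (.leaf (.signotope 3 4 5 6))
  (.split 1 3 5 (.split 5 6 7 (.split 5 6 8 (.split 4 6 7 (.split 2 4 5 (.leaf (.hole true true
  true 2 4 5 6 7)) (.split 6 7 8 (.leaf (.hole true true true 4 5 6 7 8)) (.split 4 6 8 (.split 4
  7 8 (.split 1 2 4 (.split 3 6 7 (.split 2 4 8 (.leaf (.hole true true true 0 1 2 4 8)) (.split 2
  4 7 (.leaf (.signotope 2 4 7 8)) (.split 0 1 4 (.split 1 4 7 (.leaf (.hole true true true 0 1 4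
  7 8)) (.split 2 5 7 (.split 5 7 8 (.leaf (.hole false true true 2 4 5 7 8)) (.split 3 5 7 (.leaf
  (.hole true false true 2 3 4 5 7)) (.split 2 5 6 (.leaf (.hole false true true 2 4 5 6 7))
  (.split 1 2 5 (.leaf (.hole true false true 1 2 4 5 7)) (.split 3 6 8 (.leaf (.hole false true
  false 3 5 6 7 8)) (.split 1 3 6 (.leaf (.hole false true false 1 2 3 5 6)) (.leaf (.visible 1 3
  6 8)))))))) (.leaf (.hole true false true 2 3 5 6 7)))) (.leaf (.signotope 0 1 2 4))))) (.leaf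
  (.visible 3 6 7 8))) (.leaf (.hole false true false 1 2 3 4 5))) (.leaf (.hole true true false 4
  5 6 7 8))) (.leaf (.signotope 4 5 6 8))))) (.leaf (.signotope 4 5 6 7))) (.leaf (.visible 3 5 6
  8))) (.leaf (.visible 3 5 6 7))) (.leaf (.visible 1 3 5 6))))) (.leaf (.visible 3 4 5 8)))
  (.leaf (.visible 3 4 5 7))) (.leaf (.visible 1 3 4 5)))) (.split 2 4 5 (.split 3 4 5 (.split 5 6
  7 (.split 5 6 8 (.split 1 2 4 (.leaf (.hole true true true 0 1 2 4 5)) (.split 4 5 7 (.leaf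
  (.hole true true true 2 3 4 5 7)) (.split 3 5 6 (.leaf (.hole true true true 2 3 5 6 7)) (.split
  2 5 7 (.split 1 2 5 (.leaf (.hole true true true 0 1 2 5 7)) (.split 1 3 4 (.leaf (.hole false
  true true 1 2 3 4 5)) (.split 0 1 3 (.split 3 4 6 (.split 2 5 6 (.split 0 2 5 (.leaf (.hole true
  true true 0 2 5 6 7)) (.split 6 7 8 (.leaf (.hole true true true 2 5 6 7 8)) (.split 1 3 5
  (.leaf (.hole true false true 0 1 2 3 5)) (.split 4 6 7 (.split 1 4 6 (.leaf (.hole false true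
  false 1 3 4 5 6)) (.split 3 5 7 (.split 4 6 8 (.split 5 7 8 (.leaf (.hole true true true 2 3 5 7
  8)) (.leaf (.hole false true false 4 5 6 7 8))) (.leaf (.visible 1 4 6 8))) (.leaf (.hole true
  false true 3 4 5 6 7)))) (.leaf (.visible 4 6 7 8)))))) (.leaf (.hole true true false 2 3 4 5
  6))) (.leaf (.visible 1 3 4 6))) (.leaf (.visible 0 1 3 4))))) (.split 2 5 6 (.leaf (.signotope
  2 5 6 7)) (.split 3 4 6 (.leaf (.hole true true false 2 3 4 5 6)) (.split 1 3 4 (.split 4 6 7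
  (.split 4 6 8 (.split 1 2 5 (.split 3 4 7 (.leaf (.hole true true false 2 3 4 5 7)) (.split 2 4
  6 (.leaf (.hole true false true 2 4 5 6 7)) (.split 5 7 8 (.split 2 5 8 (.leaf (.hole true true
  true 0 1 2 5 8)) (.split 1 3 6 (.leaf (.hole false true false 1 2 3 4 6)) (.split 3 6 7 (.split
  3 6 8 (.split 2 4 7 (.split 4 7 8 (.leaf (.hole true false true 2 4 5 7 8)) (.leaf (.hole false
  true false 3 4 6 7 8))) (.leaf (.hole true false true 2 3 4 6 7))) (.leaf (.visible 1 3 6 8)))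
  (.leaf (.visible 1 3 6 7))))) (.leaf (.hole false true false 4 5 6 7 8))))) (.leaf (.hole false
  true true 1 2 3 4 5))) (.leaf (.visible 3 4 6 8))) (.leaf (.visible 3 4 6 7))) (.leaf (.visible
  1 3 4 6))))))))) (.leaf (.visible 4 5 6 8))) (.leaf (.visible 4 5 6 7))) (.leaf (.visible 3 4 5
  6))) (.leaf (.visible 2 4 5 6)))) (.leaf (.visible 1 2 3 6))) (.leaf (.visible 1 2 3 5))) (.leaf
  (.visible 1 2 3 4))) (.leaf (.visible 0 1 2 3))))

theorem ninePointTree_check : ninePointTree.check [] = true := by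
  decide +kernel

theorem exists_obstruction (X : ℕ → ℕ → ℕ → Bool) :
    ∃ o : Obstruction, o.test (fun i j k s => X i j k == s) = true :=
  ninePointTree.exists_obstruction [] (by simp) ninePointTree_check

/-! ### Empty pentagons, apexes and supported pairs -/

open scoped Classical in
/-- A variant of `mem_holes_of_turn_pos`: only points on the inner side of every edge need to be
shown not to lie in the interior. -/
theorem mem_holes_of_edges {P : Finset Plane} {a b c d e : Plane}
    (ha : a ∈ P) (hb : b ∈ P) (hc : c ∈ P) (hd : d ∈ P) (he : e ∈ P)
    (abc : 0 < turn a b c) (abd : 0 < turn a b d) (abe : 0 < turn a b e)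
    (acd : 0 < turn a c d) (ace : 0 < turn a c e) (ade : 0 < turn a d e)
    (bcd : 0 < turn b c d) (bce : 0 < turn b c e) (bde : 0 < turn b d e)
    (cde : 0 < turn c d e)
    (hempty : ∀ z ∈ P, z ∈ interior (convexHull ℝ ({a, b, c, d, e} : Set Plane)) →
      0 < turn a b z → 0 < turn b c z → 0 < turn c d z → 0 < turn d e z → 0 < turn e a z →
      False) :
    ({a, b, c, d, e} : Finset Plane) ∈ holes P 5 := by
  refine mem_holes_of_turn_pos ha hb hc hd he abc abd abe acd ace ade bcd bce bde cde ?_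
  intro z hz hzi
  have r : ∀ x y z : Plane, 0 < turn x y z → 0 < turn z x y := by
    intro x y z h; rw [← turn_rotate z x y]; exact h
  have r' : ∀ x y z : Plane, 0 < turn x y z → 0 < turn y z x := by
    intro x y z h; rw [turn_rotate x y z]; exact h
  have key : ∀ u v w : Plane, 0 < turn u v w →
      0 ≤ turn u v a → 0 ≤ turn u v b → 0 ≤ turn u v c → 0 ≤ turn u v d → 0 ≤ turn u v e →
      0 < turn u v z := by
    intro u v w hw h1 h2 h3 h4 h5
    refine turn_pos_of_mem_interior hw.ne' ?_ hzi
    intro x hx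
    simp only [Set.mem_insert_iff, Set.mem_singleton_iff] at hx
    rcases hx with rfl | rfl | rfl | rfl | rfl <;> assumption
  refine hempty z hz hzi ?_ ?_ ?_ ?_ ?_
  · exact key _ _ _ abc (turn_self_outer _ _).ge (turn_self_right _ _).ge abc.le abd.le abe.le
  · exact key _ _ _ bcd (r' _ _ _ abc).le (turn_self_outer _ _).ge (turn_self_right _ _).ge
      bcd.le bce.le
  · exact key _ _ _ cde (r' _ _ _ acd).le (r' _ _ _ bcd).le (turn_self_outer _ _).ge
      (turn_self_right _ _).ge cde.le
  · exact key _ _ _ (r' _ _ _ ade) (r' _ _ _ ade).le (r' _ _ _ bde).le (r' _ _ _ cde).le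
      (turn_self_outer _ _).ge (turn_self_right _ _).ge
  · exact key _ _ _ (r _ _ _ abe) (turn_self_right _ _).ge (r _ _ _ abe).le (r _ _ _ ace).le
      (r _ _ _ ade).le (turn_self_outer _ _).ge

/-- The point `p` of `P` sees the other points of `P` within a half-plane, so that they are linearly
ordered around `p`: `x` comes before `y` when `0 < turn p y x`. -/
structure IsApex (P : Finset Plane) (p : Plane) : Prop where
  mem : p ∈ P
  trans : ∀ x ∈ P, ∀ y ∈ P, ∀ z ∈ P, 0 < turn p y x → 0 < turn p z y → 0 < turn p z x

/-- Seen from `p`, the point `a` comes before `b` and all points of `P` before `a` are beyond the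
line `a b`. -/
def SupportedBefore (P : Finset Plane) (p a b : Plane) : Prop :=
  0 < turn p b a ∧ ∀ z ∈ P, 0 < turn p a z → 0 < turn z a b

/-- Seen from `p`, the point `a` comes before `b` and all points of `P` after `b` are beyond the
line `a b`. -/
def SupportedAfter (P : Finset Plane) (p a b : Plane) : Prop :=
  0 < turn p b a ∧ ∀ z ∈ P, 0 < turn p z b → 0 < turn a b z

/-- Of two distinct such points, one comes before `a` as seen from the other. It would then have to
lie beyond the line `a b`, although both lie on its near side. -/
theorem SupportedBefore.unique {P : Finset Plane} (hP : GeneralPosition P) {p p' a b : Plane}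
    (hp : p ∈ P) (hp' : p' ∈ P) (ha : a ∈ P) (h : SupportedBefore P p a b)
    (h' : SupportedBefore P p' a b) : p = p' := by
  by_contra hne
  have hpa : p ≠ a := by
    rintro rfl; have := h.1; simp [turn_self_outer] at this
  have hpa' : p' ≠ a := by
    rintro rfl; have := h'.1; simp [turn_self_outer] at this
  have e1 : turn p' a p = -turn p a p' := by unfold turn; ring
  rcases (hP.turn_ne_zero hp ha hp' hpa hne hpa'.symm).lt_or_gt with hlt | hgt
  · have h1 := h'.2 p hp (by linarith)
    have h2 := h.1
    rw [turn_swap] at h2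
    linarith
  · have h1 := h.2 p' hp' hgt
    have h2 := h'.1
    rw [turn_swap] at h2
    linarith

/-- The mirror image: one of the two points comes after `b` as seen from the other. -/
theorem SupportedAfter.unique {P : Finset Plane} (hP : GeneralPosition P) {p p' a b : Plane}
    (hp : p ∈ P) (hp' : p' ∈ P) (hb : b ∈ P) (h : SupportedAfter P p a b)
    (h' : SupportedAfter P p' a b) : p = p' := by
  by_contra hne
  have hpb : p ≠ b := by
    rintro rfl; have := h.1; simp [turn_self_left] at this
  have hpb' : p' ≠ b := by
    rintro rfl; have := h'.1; simp [turn_self_left] at this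
  have e1 : turn p' p b = -turn p p' b := by unfold turn; ring
  have h1 := h.1
  have h1' := h'.1
  rw [← turn_rotate, turn_swap'] at h1 h1'
  rw [← turn_rotate] at h1 h1'
  rcases (hP.turn_ne_zero hp hp' hb hne hpb hpb').lt_or_gt with hlt | hgt
  · have h2 := h'.2 p hp (by linarith)
    unfold turn at *
    linarith
  · have h2 := h.2 p' hp' hgt
    unfold turn at *
    linarith

/-- Orientations of triples of four points sorted around `p` change sign at most once. -/
theorem turn_identities (p a b c d : Plane) :
    turn a b d * turn p c a = turn a b c * turn p d a + turn a c d * turn p b a ∧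
    turn a b d * turn p c b = turn a b c * turn p d b + turn b c d * turn p b a ∧
    turn a c d * turn p c b = turn a b c * turn p d c + turn b c d * turn p c a ∧
    turn a c d * turn p d b = turn a b d * turn p d c + turn b c d * turn p d a := by
  unfold turn
  refine ⟨?_, ?_, ?_, ?_⟩ <;> ring

/-- Turns `turn_identities` into sign rules: for points sorted around `p`, the factors involving `p`
are positive. -/
theorem sign_of_combo {x y z u v w : ℝ} (hu : 0 < u) (hv : 0 < v) (hw : 0 < w)
    (h : y * u = x * v + z * w) :
    (0 < x → 0 < z → 0 < y) ∧ (x < 0 → z < 0 → y < 0) := by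
  constructor
  · intro hx hz
    have : 0 < y * u := by rw [h]; positivity
    exact (pos_iff_pos_of_mul_pos this).2 hu
  · intro hx hz
    have : y * u < 0 := by
      rw [h]
      have := mul_neg_of_neg_of_pos hx hv
      have := mul_neg_of_neg_of_pos hz hw
      linarith
    by_contra! hy
    have := mul_nonneg hy hu.le
    linarith

open scoped Classical in
/-- If `a`, `b` see nothing of `P` between them on the side of `p`, and there are points of `P`
below the line `a b` both before `a` and after `b`, then `p`, `a`, `b` lie in a common `5`-hole. -/
theorem exists_hole_of_visible {P : Finset Plane} {p a b z₁ z₃ : Plane} (hp : IsApex P p)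
    (ha : a ∈ P) (hb : b ∈ P) (hz₁ : z₁ ∈ P) (hz₃ : z₃ ∈ P) (hab : 0 < turn p b a)
    (hvis : ∀ z ∈ P, 0 < turn p z a → 0 < turn p b z → turn a z b ≤ 0)
    (h₁a : 0 < turn p a z₁) (h₁ : turn z₁ a b < 0) (h₃b : 0 < turn p z₃ b)
    (h₃ : turn a b z₃ < 0) (hne : ∀ z ∈ P, z ≠ p → z ≠ a → z ≠ b → turn p a z ≠ 0 ∧
      turn p b z ≠ 0) :
    ∃ H ∈ holes P 5, p ∈ H ∧ a ∈ H ∧ b ∈ H := by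
  -- Among the points before `a` on the near side of `a b`, `x` minimises the area of the triangle
  -- with `p` and `a`, which keeps other such points out of that triangle; `y` does the same after
  -- `b`.
  obtain ⟨x, hx, hxmin⟩ := Finset.exists_min_image
    (P.filter fun z => 0 < turn p a z ∧ turn z a b < 0) (fun z => turn p a z)
    ⟨z₁, by simp [*]⟩
  obtain ⟨y, hy, hymin⟩ := Finset.exists_min_image
    (P.filter fun z => 0 < turn p z b ∧ turn a b z < 0) (fun z => turn p z b)
    ⟨z₃, by simp [*]⟩
  simp only [Finset.mem_filter] at hx hy hxmin hymin
  obtain ⟨hxP, hxa, hxab⟩ := hx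
  obtain ⟨hyP, hyb, haby⟩ := hy
  have hbx := hp.trans x hxP a ha b hb hxa hab
  have hya := hp.trans a ha b hb y hyP hab hyb
  have hyx := hp.trans x hxP a ha y hyP hxa hya
  obtain ⟨-, i2, i3, -⟩ := turn_identities p x a b y
  have hxay' : turn x a y < 0 := (sign_of_combo hab hya hxa i2).2 hxab haby
  have hxby : turn x b y < 0 := (sign_of_combo hab hyb hbx i3).2 hxab haby
  refine ⟨{p, y, b, a, x}, ?_, by simp, by simp, by simp⟩
  have e1 : turn y b a = -turn a b y := by unfold turn; ring
  have e2 : turn y b x = -turn x b y := by unfold turn; ring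
  have e3 : turn y a x = -turn x a y := by unfold turn; ring
  have e4 : turn b a x = -turn x a b := by unfold turn; ring
  refine mem_holes_of_edges hp.mem hyP hb ha hxP hyb hya hyx hab hbx hxa
    (by linarith) (by linarith) (by linarith) (by linarith) ?_
  intro z hz _ hpy hyb' hba hax hxp
  have hzp : z ≠ p := by rintro rfl; simp [turn_self_outer] at hpy
  have hza : z ≠ a := by rintro rfl; simp [turn_self_right] at hba
  have hzb : z ≠ b := by rintro rfl; simp [turn_self_outer] at hba
  obtain ⟨na, nb⟩ := hne z hz hzp hza hzb
  have f1 : turn z a b = -turn b a z := by unfold turn; ring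
  have f2 : turn p a x = turn p a z + turn a x z + turn x p z := by unfold turn; ring
  have f3 : turn p y b = turn p z b + turn p y z + turn y b z := by unfold turn; ring
  have f4 : turn a z b = turn b a z := by unfold turn; ring
  have f5 : turn a b z = -turn b a z := by unfold turn; ring
  have f6 : turn p z b = -turn p b z := by unfold turn; ring
  have f7 : turn p z a = -turn p a z := by unfold turn; ring
  -- An interior point lies after `b`, between `a` and `b`, or before `a`. This contradicts the
  -- choice of `y`, the visibility of `a b`, or the choice of `x`, respectively.
  rcases na.lt_or_gt with hlt | hgt
  · rcases nb.lt_or_gt with hlt' | hgt'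
    · have := hymin z ⟨hz, by linarith, by linarith⟩
      linarith
    · have := hvis z hz (by linarith) hgt'
      linarith
  · have := hxmin z ⟨hz, hgt, by linarith⟩
    linarith

/-! ### Windows of nine consecutive points -/

/-- `r 0, …, r 8` are consecutive points of `P` in the order around `p`. -/
structure IsWindow (P : Finset Plane) (p : Plane) (r : ℕ → Plane) : Prop where
  mem : ∀ i < 9, r i ∈ P
  lt : ∀ i j, i < j → j < 9 → 0 < turn p (r j) (r i)
  exists_eq : ∀ z ∈ P, 0 < turn p z (r 0) → 0 < turn p (r 8) z → ∃ i < 9, r i = z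

namespace IsWindow

variable {P : Finset Plane} {p : Plane} {r : ℕ → Plane}

theorem ne (hr : IsWindow P p r) {i j : ℕ} (hij : i < j) (hj : j < 9) : r i ≠ r j := by
  intro h
  have := hr.lt i j hij hj
  rw [h, turn_self_right] at this
  exact lt_irrefl _ this

theorem turn_ne_zero (hP : GeneralPosition P) (hr : IsWindow P p r) {i j k : ℕ} (hij : i < j)
    (hjk : j < k) (hk : k < 9) : turn (r i) (r j) (r k) ≠ 0 :=
  hP.turn_ne_zero (hr.mem i (by omega)) (hr.mem j (by omega)) (hr.mem k hk) (hr.ne hij (by omega))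
    (hr.ne (hij.trans hjk) hk) (hr.ne hjk hk)

theorem exists_index (hp : IsApex P p) (hr : IsWindow P p r) {a e : ℕ} (ha : a < 9) (he : e < 9)
    {z : Plane} (hz : z ∈ P) (haz : 0 < turn p z (r a)) (hze : 0 < turn p (r e) z) :
    ∃ m, a < m ∧ m < e ∧ r m = z := by
  have h0 : 0 < turn p z (r 0) := by
    rcases a.eq_zero_or_pos with rfl | h
    · exact haz
    · exact hp.trans _ (hr.mem 0 (by omega)) _ (hr.mem a ha) _ hz (hr.lt 0 a h ha) haz
  have h8 : 0 < turn p (r 8) z := by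
    rcases (Nat.le_of_lt_succ he).eq_or_lt with rfl | h
    · exact hze
    · exact hp.trans _ hz _ (hr.mem e he) _ (hr.mem 8 (by omega)) hze (hr.lt e 8 h (by omega))
  obtain ⟨m, hm, rfl⟩ := hr.exists_eq z hz h0 h8
  have key : ∀ i j, i < 9 → 0 < turn p (r j) (r i) → i < j := by
    intro i j hi h
    rcases lt_trichotomy i j with hlt | rfl | hgt
    · exact hlt
    · rw [turn_self_right] at h; exact absurd h (lt_irrefl _)
    · have := hr.lt j i hgt hi
      rw [turn_swap] at this
      linarith
  exact ⟨m, key _ _ ha haz, key _ _ hm hze, rfl⟩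

/-- The rays from `p` through `r a` and `r e` bound a sector containing the pentagon, so emptiness
has to be tested only on points of the window. -/
theorem exists_index_of_mem_interior (hp : IsApex P p) (hr : IsWindow P p r) {a b c d e : ℕ}
    (hab : a < b) (hbc : b < c) (hcd : c < d) (hde : d < e) (he : e < 9) {S : Set Plane}
    (hS : S ⊆ {r a, r b, r c, r d, r e}) {z : Plane} (hz : z ∈ P)
    (hzi : z ∈ interior (convexHull ℝ S)) : ∃ m, a < m ∧ m < e ∧ r m = z := by
  refine hr.exists_index hp (by omega) he hz ?_ ?_
  · have : 0 < turn (r a) p z := by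
      refine turn_pos_of_mem_interior (w := r e) ?_ ?_ hzi
      · rw [← turn_rotate, turn_rotate, ← turn_rotate]
        exact (hr.lt a e (by omega) he).ne'
      · intro x hx
        rw [← turn_rotate, turn_rotate, ← turn_rotate]
        rcases hS hx with rfl | rfl | rfl | rfl | rfl
        · rw [turn_self_right]
        · exact (hr.lt a b (by omega) (by omega)).le
        · exact (hr.lt a c (by omega) (by omega)).le
        · exact (hr.lt a d (by omega) (by omega)).le
        · exact (hr.lt a e (by omega) (by omega)).le
    rw [← turn_rotate, turn_rotate, ← turn_rotate] at this
    exact this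
  · refine turn_pos_of_mem_interior (w := r a) ?_ ?_ hzi
    · exact (hr.lt a e (by omega) he).ne'
    · intro x hx
      rcases hS hx with rfl | rfl | rfl | rfl | rfl
      · exact (hr.lt a e (by omega) (by omega)).le
      · exact (hr.lt b e (by omega) (by omega)).le
      · exact (hr.lt c e (by omega) (by omega)).le
      · exact (hr.lt d e (by omega) (by omega)).le
      · rw [turn_self_right]

/-- The orientation of a triple of a window, as a Boolean. -/
noncomputable def orient (r : ℕ → Plane) (i j k : ℕ) : Bool :=
  decide (0 < turn (r i) (r j) (r k))

theorem turn_pos_of_orient {r : ℕ → Plane} {i j k : ℕ} (h : orient r i j k = true) :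
    0 < turn (r i) (r j) (r k) := by
  simpa [orient] using h

theorem turn_neg_of_orient (hP : GeneralPosition P) (hr : IsWindow P p r) {i j k : ℕ} (hij : i < j)
    (hjk : j < k) (hk : k < 9) (h : orient r i j k = false) : turn (r i) (r j) (r k) < 0 := by
  have : turn (r i) (r j) (r k) ≤ 0 := by simpa [orient] using h
  exact this.lt_of_ne (hr.turn_ne_zero hP hij hjk hk)

/-- Orientations of triples of four points of a window change at most once. -/
theorem orient_signotope (hP : GeneralPosition P) (hr : IsWindow P p r) {a b c d : ℕ}
    (hab : a < b) (hbc : b < c) (hcd : c < d) (hd : d < 9) :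
    (orient r a b c = orient r a c d → orient r a b d = orient r a b c) ∧
    (orient r a b c = orient r b c d → orient r a b d = orient r a b c) ∧
    (orient r a b c = orient r b c d → orient r a c d = orient r a b c) ∧
    (orient r a b d = orient r b c d → orient r a c d = orient r a b d) := by
  obtain ⟨i1, i2, i3, i4⟩ := turn_identities p (r a) (r b) (r c) (r d)
  have h1 := hr.lt a b (by omega) (by omega)
  have h2 := hr.lt a c (by omega) (by omega)
  have h3 := hr.lt a d (by omega) (by omega)
  have h4 := hr.lt b c (by omega) (by omega)
  have h5 := hr.lt b d (by omega) (by omega)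
  have h6 := hr.lt c d (by omega) (by omega)
  have n1 := hr.turn_ne_zero hP hab hbc (by omega)
  have n2 := hr.turn_ne_zero hP hab (hbc.trans hcd) hd
  have n3 := hr.turn_ne_zero hP (hab.trans hbc) hcd hd
  have n4 := hr.turn_ne_zero hP hbc hcd hd
  have key : ∀ {x y z u v w : ℝ}, 0 < u → 0 < v → 0 < w → x ≠ 0 → z ≠ 0 → y * u = x * v + z * w →
      decide (0 < x) = decide (0 < z) → decide (0 < y) = decide (0 < x) := by
    intro x y z u v w hu hv hw hx hz h hxz
    obtain ⟨h₁, h₂⟩ := sign_of_combo hu hv hw h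
    rcases hx.lt_or_gt with hx | hx <;> rcases hz.lt_or_gt with hz | hz
    · simp [hx.not_gt, (h₂ hx hz).not_gt]
    · simp [hx.not_gt, hz] at hxz
    · simp [hz.not_gt, hx] at hxz
    · simp [hx, h₁ hx hz]
  exact ⟨key h2 h3 h1 n1 n3 i1, key h4 h5 h1 n1 n4 i2, key h4 h6 h2 n1 n4 i3, key h5 h6 h3 n2 n4 i4⟩

/-- In a window, a chain of points below and a chain above its end points span a convex pentagon:
the orientation of a triple is determined by the chain its middle point belongs to. -/
theorem orient_eq_of_chains (hP : GeneralPosition P) (hr : IsWindow P p r) {a b c d e : ℕ}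
    (hab : a < b) (hbc : b < c) (hcd : c < d) (hde : d < e) (he : e < 9) (sb sc sd : Bool)
    (hlow : turnsAre (fun i j k s => orient r i j k == s) true (chain sb sc sd a b c d e) = true)
    (hup : turnsAre (fun i j k s => orient r i j k == s) false
      (chain (!sb) (!sc) (!sd) a b c d e) = true) :
    (orient r a b c = sb ∧ orient r a b d = sb ∧ orient r a b e = sb) ∧
    (orient r a c d = sc ∧ orient r a c e = sc ∧ orient r b c d = sc ∧ orient r b c e = sc) ∧
    (orient r a d e = sd ∧ orient r b d e = sd ∧ orient r c d e = sd) := by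
  have q1 := hr.orient_signotope hP hab hbc hcd (by omega)
  have q2 := hr.orient_signotope hP hab hbc (hcd.trans hde) (by omega)
  have q3 := hr.orient_signotope hP hab (hbc.trans hcd) hde (by omega)
  have q4 := hr.orient_signotope hP (hab.trans hbc) hcd hde (by omega)
  have q5 := hr.orient_signotope hP hbc hcd hde (by omega)
  cases sb <;> cases sc <;> cases sd <;>
  simp only [chain, turnsAre, cond_true, cond_false, List.cons_append, List.nil_append,
    Bool.not_true, Bool.not_false, Bool.and_true, Bool.and_eq_true, beq_iff_eq] at hlow hup <;>
  cases h : orient r a b c <;> grind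

/-- Treats both orientations at once and supplies every cyclic rotation, so that the eight shapes of
pentagon can find their positivity conditions by assumption. -/
theorem turn_pos_of_orient_eq (hP : GeneralPosition P) (hr : IsWindow P p r) {s : Bool} {i j k : ℕ}
    (hij : i < j) (hjk : j < k) (hk : k < 9) (h : orient r i j k = s) :
    0 < turn (r i) (r (cond s j k)) (r (cond s k j)) ∧
      0 < turn (r (cond s j k)) (r (cond s k j)) (r i) ∧
      0 < turn (r (cond s k j)) (r i) (r (cond s j k)) := by
  have h0 : 0 < turn (r i) (r (cond s j k)) (r (cond s k j)) := by
    cases s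
    · have := turn_neg_of_orient hP hr hij hjk hk h
      rw [cond_false, cond_false, turn_swap]
      linarith
    · exact turn_pos_of_orient h
  exact ⟨h0, by rwa [turn_rotate], by rwa [← turn_rotate]⟩

theorem not_orient_of_turn_pos {u v m : ℕ} (h : 0 < turn (r u) (r v) (r m)) :
    orient r u m v ≠ true := by
  intro h'
  have := turn_pos_of_orient h'
  rw [turn_swap] at this
  linarith

theorem orient_of_turn_pos {u v m : ℕ} (h : 0 < turn (r v) (r u) (r m)) :
    orient r u m v ≠ false := by
  intro h'
  have : turn (r u) (r m) (r v) ≤ 0 := by simpa [orient] using h'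
  unfold turn at *
  linarith

open scoped Classical in
/-- An empty pentagon of a window, given by its lower and its upper chain, is a `5`-hole. -/
theorem exists_hole_of_chains (hP : GeneralPosition P) (hp : IsApex P p) (hr : IsWindow P p r)
    {a b c d e : ℕ} (hab : a < b) (hbc : b < c) (hcd : c < d) (hde : d < e) (he : e < 9)
    (sb sc sd : Bool)
    (hlow : turnsAre (fun i j k s => orient r i j k == s) true (chain sb sc sd a b c d e) = true)
    (hup : turnsAre (fun i j k s => orient r i j k == s) false
      (chain (!sb) (!sc) (!sd) a b c d e) = true)
    (hbeyond : ∀ x, a < x → x < e → x = b ∨ x = c ∨ x = d ∨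
      isBeyond (fun i j k s => orient r i j k == s) true x (chain sb sc sd a b c d e) = true ∨
      isBeyond (fun i j k s => orient r i j k == s) false x
        (chain (!sb) (!sc) (!sd) a b c d e) = true) :
    ∃ H ∈ holes P 5, r a ∈ H ∧ r b ∈ H ∧ r c ∈ H ∧ r d ∈ H ∧ r e ∈ H := by
  have ma := hr.mem a (by omega)
  have mb := hr.mem b (by omega)
  have mc := hr.mem c (by omega)
  have md := hr.mem d (by omega)
  have me := hr.mem e he
  have idx := fun {S : Set Plane} (hS : S ⊆ {r a, r b, r c, r d, r e}) {z : Plane} =>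
    hr.exists_index_of_mem_interior (z := z) hp hab hbc hcd hde he hS
  obtain ⟨⟨h1, h2, h3⟩, ⟨h4, h5, h6, h7⟩, h8, h9, h10⟩ :=
    hr.orient_eq_of_chains hP hab hbc hcd hde he sb sc sd hlow hup
  have self1 : ∀ {u v : ℕ}, ¬ 0 < turn (r u) (r v) (r u) := by
    intro u v; rw [turn_self_outer]; exact lt_irrefl _
  have self2 : ∀ {u v : ℕ}, ¬ 0 < turn (r u) (r v) (r v) := by
    intro u v; rw [turn_self_right]; exact lt_irrefl _
  obtain ⟨h1a, h1b, h1c⟩ := hr.turn_pos_of_orient_eq hP (by omega) (by omega) (by omega) h1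
  obtain ⟨h2a, h2b, h2c⟩ := hr.turn_pos_of_orient_eq hP (by omega) (by omega) (by omega) h2
  obtain ⟨h3a, h3b, h3c⟩ := hr.turn_pos_of_orient_eq hP (by omega) (by omega) (by omega) h3
  obtain ⟨h4a, h4b, h4c⟩ := hr.turn_pos_of_orient_eq hP (by omega) (by omega) (by omega) h4
  obtain ⟨h5a, h5b, h5c⟩ := hr.turn_pos_of_orient_eq hP (by omega) (by omega) (by omega) h5
  obtain ⟨h6a, h6b, h6c⟩ := hr.turn_pos_of_orient_eq hP (by omega) (by omega) (by omega) h6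
  obtain ⟨h7a, h7b, h7c⟩ := hr.turn_pos_of_orient_eq hP (by omega) (by omega) (by omega) h7
  obtain ⟨h8a, h8b, h8c⟩ := hr.turn_pos_of_orient_eq hP (by omega) (by omega) (by omega) h8
  obtain ⟨h9a, h9b, h9c⟩ := hr.turn_pos_of_orient_eq hP (by omega) (by omega) (by omega) h9
  obtain ⟨h10a, h10b, h10c⟩ := hr.turn_pos_of_orient_eq hP (by omega) (by omega) (by omega) h10
  clear h1 h2 h3 h4 h5 h6 h7 h8 h9 h10 hlow hup
  -- One case for each distribution of the inner vertices. Counterclockwise, the pentagon follows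
  -- the lower chain from `a` to `e` and returns along the upper one.
  cases sb <;> cases sc <;> cases sd <;>
  simp only [chain, isBeyond, cond_true, cond_false, List.cons_append, List.nil_append,
    Bool.not_true, Bool.not_false, Bool.or_eq_true, Bool.and_eq_true, Nat.blt_eq, beq_iff_eq,
    Bool.or_false] at *
  · refine ⟨{r a, r e, r d, r c, r b}, mem_holes_of_edges ma me md mc mb ‹_› ‹_› ‹_› ‹_› ‹_› ‹_› ‹_› ‹_› ‹_› ‹_›
      ?_, by simp, by simp, by simp, by simp, by simp⟩
    intro z hz hzi e1 e2 e3 e4 e5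
    obtain ⟨m, ham, hme, rfl⟩ := idx
      (by rintro x (rfl | rfl | rfl | rfl | rfl) <;> simp) hz hzi
    rcases hbeyond m ham hme with rfl | rfl | rfl | h
    · exact self1 e5
    · exact self1 e4
    · exact self1 e3
    · rcases h with (h) | (h | h | h | h)
      · exact not_orient_of_turn_pos e1 h.2
      · exact orient_of_turn_pos e5 h.2
      · exact orient_of_turn_pos e4 h.2
      · exact orient_of_turn_pos e3 h.2
      · exact orient_of_turn_pos e2 h.2
  · refine ⟨{r a, r d, r e, r c, r b}, mem_holes_of_edges ma md me mc mb ‹_› ‹_› ‹_› ‹_› ‹_› ‹_› ‹_› ‹_› ‹_› ‹_›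
      ?_, by simp, by simp, by simp, by simp, by simp⟩
    intro z hz hzi e1 e2 e3 e4 e5
    obtain ⟨m, ham, hme, rfl⟩ := idx
      (by rintro x (rfl | rfl | rfl | rfl | rfl) <;> simp) hz hzi
    rcases hbeyond m ham hme with rfl | rfl | rfl | h
    · exact self1 e5
    · exact self1 e4
    · exact self1 e2
    · rcases h with (h | h) | (h | h | h)
      · exact not_orient_of_turn_pos e1 h.2
      · exact not_orient_of_turn_pos e2 h.2
      · exact orient_of_turn_pos e5 h.2
      · exact orient_of_turn_pos e4 h.2
      · exact orient_of_turn_pos e3 h.2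
  · refine ⟨{r a, r c, r e, r d, r b}, mem_holes_of_edges ma mc me md mb ‹_› ‹_› ‹_› ‹_› ‹_› ‹_› ‹_› ‹_› ‹_› ‹_›
      ?_, by simp, by simp, by simp, by simp, by simp⟩
    intro z hz hzi e1 e2 e3 e4 e5
    obtain ⟨m, ham, hme, rfl⟩ := idx
      (by rintro x (rfl | rfl | rfl | rfl | rfl) <;> simp) hz hzi
    rcases hbeyond m ham hme with rfl | rfl | rfl | h
    · exact self1 e5
    · exact self1 e2
    · exact self1 e4
    · rcases h with (h | h) | (h | h | h)
      · exact not_orient_of_turn_pos e1 h.2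
      · exact not_orient_of_turn_pos e2 h.2
      · exact orient_of_turn_pos e5 h.2
      · exact orient_of_turn_pos e4 h.2
      · exact orient_of_turn_pos e3 h.2
  · refine ⟨{r a, r c, r d, r e, r b}, mem_holes_of_edges ma mc md me mb ‹_› ‹_› ‹_› ‹_› ‹_› ‹_› ‹_› ‹_› ‹_› ‹_›
      ?_, by simp, by simp, by simp, by simp, by simp⟩
    intro z hz hzi e1 e2 e3 e4 e5
    obtain ⟨m, ham, hme, rfl⟩ := idx
      (by rintro x (rfl | rfl | rfl | rfl | rfl) <;> simp) hz hzi
    rcases hbeyond m ham hme with rfl | rfl | rfl | h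
    · exact self1 e5
    · exact self1 e2
    · exact self1 e3
    · rcases h with (h | h | h) | (h | h)
      · exact not_orient_of_turn_pos e1 h.2
      · exact not_orient_of_turn_pos e2 h.2
      · exact not_orient_of_turn_pos e3 h.2
      · exact orient_of_turn_pos e5 h.2
      · exact orient_of_turn_pos e4 h.2
  · refine ⟨{r a, r b, r e, r d, r c}, mem_holes_of_edges ma mb me md mc ‹_› ‹_› ‹_› ‹_› ‹_› ‹_› ‹_› ‹_› ‹_› ‹_›
      ?_, by simp, by simp, by simp, by simp, by simp⟩
    intro z hz hzi e1 e2 e3 e4 e5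
    obtain ⟨m, ham, hme, rfl⟩ := idx
      (by rintro x (rfl | rfl | rfl | rfl | rfl) <;> simp) hz hzi
    rcases hbeyond m ham hme with rfl | rfl | rfl | h
    · exact self1 e2
    · exact self1 e5
    · exact self1 e4
    · rcases h with (h | h) | (h | h | h)
      · exact not_orient_of_turn_pos e1 h.2
      · exact not_orient_of_turn_pos e2 h.2
      · exact orient_of_turn_pos e5 h.2
      · exact orient_of_turn_pos e4 h.2
      · exact orient_of_turn_pos e3 h.2
  · refine ⟨{r a, r b, r d, r e, r c}, mem_holes_of_edges ma mb md me mc ‹_› ‹_› ‹_› ‹_› ‹_› ‹_› ‹_› ‹_› ‹_› ‹_›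
      ?_, by simp, by simp, by simp, by simp, by simp⟩
    intro z hz hzi e1 e2 e3 e4 e5
    obtain ⟨m, ham, hme, rfl⟩ := idx
      (by rintro x (rfl | rfl | rfl | rfl | rfl) <;> simp) hz hzi
    rcases hbeyond m ham hme with rfl | rfl | rfl | h
    · exact self1 e2
    · exact self1 e5
    · exact self1 e3
    · rcases h with (h | h | h) | (h | h)
      · exact not_orient_of_turn_pos e1 h.2
      · exact not_orient_of_turn_pos e2 h.2
      · exact not_orient_of_turn_pos e3 h.2
      · exact orient_of_turn_pos e5 h.2
      · exact orient_of_turn_pos e4 h.2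
  · refine ⟨{r a, r b, r c, r e, r d}, mem_holes_of_edges ma mb mc me md ‹_› ‹_› ‹_› ‹_› ‹_› ‹_› ‹_› ‹_› ‹_› ‹_›
      ?_, by simp, by simp, by simp, by simp, by simp⟩
    intro z hz hzi e1 e2 e3 e4 e5
    obtain ⟨m, ham, hme, rfl⟩ := idx
      (by rintro x (rfl | rfl | rfl | rfl | rfl) <;> simp) hz hzi
    rcases hbeyond m ham hme with rfl | rfl | rfl | h
    · exact self1 e2
    · exact self1 e3
    · exact self1 e5
    · rcases h with (h | h | h) | (h | h)
      · exact not_orient_of_turn_pos e1 h.2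
      · exact not_orient_of_turn_pos e2 h.2
      · exact not_orient_of_turn_pos e3 h.2
      · exact orient_of_turn_pos e5 h.2
      · exact orient_of_turn_pos e4 h.2
  · refine ⟨{r a, r b, r c, r d, r e}, mem_holes_of_edges ma mb mc md me ‹_› ‹_› ‹_› ‹_› ‹_› ‹_› ‹_› ‹_› ‹_› ‹_›
      ?_, by simp, by simp, by simp, by simp, by simp⟩
    intro z hz hzi e1 e2 e3 e4 e5
    obtain ⟨m, ham, hme, rfl⟩ := idx
      (by rintro x (rfl | rfl | rfl | rfl | rfl) <;> simp) hz hzi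
    rcases hbeyond m ham hme with rfl | rfl | rfl | h
    · exact self1 e2
    · exact self1 e3
    · exact self1 e4
    · rcases h with (h | h | h | h) | (h)
      · exact not_orient_of_turn_pos e1 h.2
      · exact not_orient_of_turn_pos e2 h.2
      · exact not_orient_of_turn_pos e3 h.2
      · exact not_orient_of_turn_pos e4 h.2
      · exact orient_of_turn_pos e5 h.2

/-- A window contains every point of `P` between two of its members, so visibility is a condition on
window indices alone. General position makes the weak inequalities strict. -/
theorem exists_hole_of_visible (hP : GeneralPosition P) (hp : IsApex P p) (hr : IsWindow P p r)
    {i j : ℕ} (hij : i < j) (hj : j < 9) {z₁ z₃ : Plane} (hz₁ : z₁ ∈ P) (hz₃ : z₃ ∈ P)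
    (hvis : ∀ m, i < m → m < j → orient r i m j = false)
    (h₁a : 0 < turn p (r i) z₁) (h₁ : turn z₁ (r i) (r j) ≤ 0)
    (h₃b : 0 < turn p z₃ (r j)) (h₃ : turn (r i) (r j) z₃ ≤ 0) :
    ∃ H ∈ holes P 5, p ∈ H ∧ r i ∈ H ∧ r j ∈ H := by
  have hi : i < 9 := hij.trans hj
  have mi := hr.mem i hi
  have mj := hr.mem j hj
  have hlt := hr.lt i j hij hj
  have ne : ∀ {x y : Plane}, 0 < turn p y x → p ≠ x ∧ p ≠ y ∧ x ≠ y := by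
    intro x y h
    refine ⟨?_, ?_, ?_⟩ <;> rintro rfl
    · simp [turn_self_outer] at h
    · simp [turn_self_left] at h
    · simp [turn_self_right] at h
  have h₁b := hp.trans _ hz₁ _ mi _ mj h₁a hlt
  have h₃a := hp.trans _ mi _ mj _ hz₃ hlt h₃b
  refine _root_.exists_hole_of_visible hp mi mj hz₁ hz₃ hlt ?_ h₁a ?_ h₃b ?_ ?_
  · intro z hz hiz hzj
    obtain ⟨m, him, hmj, rfl⟩ := hr.exists_index hp hi hj hz hiz hzj
    simpa [orient] using hvis m him hmj
  · exact h₁.lt_of_ne (hP.turn_ne_zero hz₁ mi mj (ne h₁a).2.2 (ne h₁b).2.2 (ne hlt).2.2)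
  · exact h₃.lt_of_ne (hP.turn_ne_zero mi mj hz₃ (ne hlt).2.2 (ne h₃a).2.2 (ne h₃b).2.2)
  · intro z hz hzp hzi hzj
    exact ⟨hP.turn_ne_zero hp.mem mi hz (ne hlt).1 hzp.symm hzi.symm,
      hP.turn_ne_zero hp.mem mj hz (ne hlt).2.1 hzp.symm hzj.symm⟩

/-- Every window of `p` yields a `5`-hole that has `p` as a vertex, or has an edge which is
supported with respect to `p`. -/
theorem exists_hole (hP : GeneralPosition P) (hp : IsApex P p) (hr : IsWindow P p r) :
    ∃ H ∈ holes P 5, ∃ i < 9, r i ∈ H ∧ (p ∈ H ∨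
      ∃ b ∈ H, SupportedBefore P p (r i) b ∨ SupportedAfter P p (r i) b) := by
  have edge : ∀ H ∈ holes P 5, ∀ i, i + 1 < 9 → r i ∈ H → r (i + 1) ∈ H →
      ∃ H ∈ holes P 5, ∃ i < 9, r i ∈ H ∧ (p ∈ H ∨
        ∃ b ∈ H, SupportedBefore P p (r i) b ∨ SupportedAfter P p (r i) b) := by
    intro H hH i hi hiH hiH'
    -- No point lies between neighbours, so visibility is vacuous. Failure of both kinds of support
    -- gives exactly the near-side points needed for a 5-hole through `p`.
    by_cases hs : SupportedBefore P p (r i) (r (i + 1)) ∨ SupportedAfter P p (r i) (r (i + 1))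
    · exact ⟨H, hH, i, by omega, hiH, Or.inr ⟨_, hiH', hs⟩⟩
    · have hlt := hr.lt i (i + 1) (by omega) hi
      simp only [SupportedBefore, SupportedAfter, not_or, not_and, not_forall, not_lt] at hs
      obtain ⟨z₁, hz₁, h₁a, h₁⟩ := hs.1 hlt
      obtain ⟨z₃, hz₃, h₃b, h₃⟩ := hs.2 hlt
      obtain ⟨H', hH', hpH', hiH', -⟩ := hr.exists_hole_of_visible hP hp (by omega) hi hz₁ hz₃
        (fun m _ _ => by omega) h₁a h₁ h₃b h₃
      exact ⟨H', hH', i, by omega, hiH', Or.inl hpH'⟩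
  obtain ⟨o, ho⟩ := exists_obstruction (orient r)
  cases o with
  | signotope a b c d =>
    exfalso
    simp only [Obstruction.test, Bool.and_eq_true, Nat.blt_eq, List.any_cons, List.any_nil,
      Bool.or_eq_true, beq_iff_eq, Bool.not_true, Bool.not_false] at ho
    obtain ⟨⟨⟨⟨hab, hbc⟩, hcd⟩, hd⟩, ho⟩ := ho
    have := hr.orient_signotope hP hab hbc hcd hd
    grind
  | visible k i j l =>
    simp only [Obstruction.test, Bool.and_eq_true, Nat.blt_eq, beq_iff_eq, List.all_eq_true,
      List.mem_range, Bool.or_eq_true, Nat.ble_eq] at ho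
    obtain ⟨⟨⟨⟨⟨⟨hki, hij⟩, hjl⟩, hl⟩, hkij⟩, hijl⟩, hvis⟩ := ho
    obtain ⟨H, hH, hpH, hiH, -⟩ := hr.exists_hole_of_visible hP hp hij (by omega)
      (hr.mem k (by omega)) (hr.mem l hl)
      (fun m him hmj => (hvis m hmj).resolve_left (by omega))
      (hr.lt k i hki (by omega)) (by simpa [orient] using hkij)
      (hr.lt j l hjl hl) (by simpa [orient] using hijl)
    exact ⟨H, hH, i, by omega, hiH, Or.inl hpH⟩
  | hole sb sc sd a b c d e =>
    simp only [Obstruction.test, Bool.and_eq_true, Nat.blt_eq, List.all_eq_true,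
      List.mem_range, Bool.or_eq_true, Nat.ble_eq, Nat.beq_eq] at ho
    obtain ⟨⟨⟨⟨⟨⟨⟨⟨hab, hbc⟩, hcd⟩, hde⟩, he⟩, hcons⟩, hlow⟩, hup⟩, hbeyond⟩ := ho
    obtain ⟨H, hH, ha', hb', hc', hd', he'⟩ := hr.exists_hole_of_chains hP hp hab hbc hcd hde he
      sb sc sd hlow hup (fun x hax hxe => by
        have := hbeyond x hxe
        have := not_le.2 hax
        tauto)
    rcases hcons with ((rfl | rfl) | rfl) | rfl
    · exact edge H hH a (by omega) ha' hb'
    · exact edge H hH b (by omega) hb' hc'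
    · exact edge H hH c (by omega) hc' hd'
    · exact edge H hH d (by omega) hd' he'

end IsWindow

/-! ### Hull vertices and the charging argument -/

open scoped Classical in
/-- The points around an apex can be listed in their order. -/
theorem IsApex.exists_enumeration {P : Finset Plane} (hP : GeneralPosition P) {p : Plane}
    (hp : IsApex P p) :
    ∃ q : ℕ → Plane, (∀ i < P.card - 1, q i ∈ P) ∧
      (∀ i j, i < j → j < P.card - 1 → 0 < turn p (q j) (q i)) ∧
      ∀ z ∈ P, z ≠ p → ∃ i < P.card - 1, q i = z := by
  let α := {z // z ∈ P.erase p}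
  have hα : ∀ x : α, x.1 ∈ P ∧ x.1 ≠ p := fun x => (Finset.mem_erase.1 x.2).symm
  have htot : ∀ x y : α, x ≠ y → 0 < turn p y.1 x.1 ∨ 0 < turn p x.1 y.1 := by
    intro x y hxy
    have := hP.turn_ne_zero hp.mem (hα x).1 (hα y).1 (hα x).2.symm (hα y).2.symm
      (fun h => hxy (Subtype.ext h))
    rcases this.lt_or_gt with h | h
    · left; rw [turn_swap]; linarith
    · right; exact h
  have hanti : ∀ x y : α, 0 < turn p y.1 x.1 → ¬ 0 < turn p x.1 y.1 := by
    intro x y h h'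
    rw [turn_swap] at h'
    linarith
  let _ : LinearOrder α :=
    { le := fun x y => x = y ∨ 0 < turn p y.1 x.1
      le_refl := fun x => Or.inl rfl
      le_trans := by
        rintro x y z (rfl | hxy) (rfl | hyz)
        · exact Or.inl rfl
        · exact Or.inr hyz
        · exact Or.inr hxy
        · exact Or.inr (hp.trans _ (hα x).1 _ (hα y).1 _ (hα z).1 hxy hyz)
      le_antisymm := by
        rintro x y (h | h) (h' | h')
        · exact h
        · exact h
        · exact h'.symm
        · exact absurd h' (hanti _ _ h)
      le_total := by
        intro x y
        by_cases h : x = y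
        · exact Or.inl (Or.inl h)
        · exact (htot x y h).imp Or.inr Or.inr
      toDecidableLE := Classical.decRel _ }
  have hcard : Fintype.card α = P.card - 1 := by
    rw [Fintype.card_coe, Finset.card_erase_of_mem hp.mem]
  let f : Fin (P.card - 1) ≃o α := monoEquivOfFin α hcard
  refine ⟨fun i => if h : i < P.card - 1 then (f ⟨i, h⟩).1 else p, ?_, ?_, ?_⟩
  · intro i hi
    simp only [hi, dif_pos]
    exact (hα _).1
  · intro i j hij hj
    have hi := hij.trans hj
    simp only [hi, hj, dif_pos]
    have hle : f ⟨i, hi⟩ ≤ f ⟨j, hj⟩ := f.monotone (by simpa using hij.le)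
    rcases hle with h | h
    · exact absurd (f.injective h) (by simp [hij.ne])
    · exact h
  · intro z hz hzp
    obtain ⟨i, hi⟩ := f.surjective ⟨z, Finset.mem_erase.2 ⟨hzp, hz⟩⟩
    refine ⟨i, i.2, ?_⟩
    simp [hi]

/-- Vertices of the convex hull are apexes. -/
theorem isApex_of_mem_firstLayer {P : Finset Plane} (hP : GeneralPosition P) (h3 : 3 ≤ P.card)
    {p : Plane} (hp : p ∈ firstLayer P) : IsApex P p := by
  simp only [firstLayer, Finset.mem_filter] at hp
  obtain ⟨hpP, hpf⟩ := hp
  have hint : (interior (convexHull ℝ (P : Set Plane))).Nonempty := by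
    obtain ⟨a, ha, b, hb, c, hc, hab, hac, hbc⟩ := Finset.two_lt_card.1 h3
    rw [interior_convexHull_nonempty_iff_affineSpan_eq_top]
    have hind : AffineIndependent ℝ ![a, b, c] :=
      affineIndependent_iff_not_collinear_set.2 (hP a ha b hb c hc hab hac hbc)
    have htop := hind.affineSpan_eq_top_iff_card_eq_finrank_add_one.2 (by simp)
    refine top_le_iff.1 (htop.ge.trans (affineSpan_mono ℝ ?_))
    rintro _ ⟨i, rfl⟩
    fin_cases i <;> simpa
  -- A line supporting the hull at `p`: all of `P` lies in the half-plane `f ≤ f p`.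
  obtain ⟨f, hf⟩ := geometric_hahn_banach_open_point
    (convex_convexHull ℝ (P : Set Plane)).interior isOpen_interior hpf.2
  have hle : ∀ x ∈ P, f x ≤ f p := by
    intro x hx
    have hcl : closure (interior (convexHull ℝ (P : Set Plane))) ⊆ {y | f y ≤ f p} :=
      closure_minimal (fun y hy => (hf y hy).le) (isClosed_le (by fun_prop) (by fun_prop))
    rw [(convex_convexHull ℝ (P : Set Plane)).closure_interior_eq_closure_of_nonempty_interior hint]
      at hcl
    exact hcl (subset_closure (subset_convexHull ℝ _ hx))
  obtain ⟨w, hw⟩ := hint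
  have hfw := hf w hw
  set s := f (EuclideanSpace.single 0 1)
  set t := f (EuclideanSpace.single 1 1)
  have hfx : ∀ x : Plane, f x = x 0 * s + x 1 * t := by
    intro x
    have : x = x 0 • EuclideanSpace.single 0 1 + x 1 • EuclideanSpace.single 1 1 := by
      ext i; fin_cases i <;> simp
    conv_lhs => rw [this]
    simp [s, t]
  have hst : s ≠ 0 ∨ t ≠ 0 := by
    by_contra! h
    rw [hfx, hfx, h.1, h.2] at hfw
    simp at hfw
  refine ⟨hpP, ?_⟩
  intro x hx y hy z hz hxy hyz
  have ex := hle x hx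
  have ey := hle y hy
  have ez := hle z hz
  rw [hfx x, hfx p] at ex
  rw [hfx y, hfx p] at ey
  rw [hfx z, hfx p] at ez
  -- The linear relation between the three plane vectors from `p` to `x`, `y`, `z`, evaluated under
  -- `f`. All weights are nonnegative, and those of `x` and `z` cannot both vanish, as `p`, `x`, `z`
  -- would then lie on the supporting line.
  have id1 : turn p z x * (p 0 * s + p 1 * t - (y 0 * s + y 1 * t)) =
      turn p y x * (p 0 * s + p 1 * t - (z 0 * s + z 1 * t)) +
      turn p z y * (p 0 * s + p 1 * t - (x 0 * s + x 1 * t)) := by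
    unfold turn; ring
  have hsum : 0 < turn p z x * (p 0 * s + p 1 * t - (y 0 * s + y 1 * t)) := by
    rw [id1]
    rcases ez.lt_or_eq with h | h
    · have := mul_pos hxy (sub_pos.2 h)
      have := mul_nonneg hyz.le (sub_nonneg.2 ex)
      linarith
    · rcases ex.lt_or_eq with h' | h'
      · have := mul_pos hyz (sub_pos.2 h')
        have := mul_nonneg hxy.le (sub_nonneg.2 ez)
        linarith
      · exfalso
        have hne : ∀ {x y : Plane}, 0 < turn p y x → p ≠ x ∧ p ≠ y := by
          intro x y h
          constructor <;> rintro rfl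
          · simp [turn_self_outer] at h
          · simp [turn_self_left] at h
        have hzx : z ≠ x := by
          rintro rfl
          rw [turn_swap] at hxy
          linarith
        apply hP.turn_ne_zero hpP hz hx (hne hyz).2 (hne hxy).1 hzx
        rcases hst with h0 | h0 <;> refine (mul_eq_zero.1 ?_).resolve_left h0 <;> unfold turn
        · linear_combination (x 1 - p 1) * h - (z 1 - p 1) * h'
        · linear_combination (z 0 - p 0) * h' - (x 0 - p 0) * h
  by_contra! hneg
  have := mul_nonneg (neg_nonneg.2 hneg) (sub_nonneg.2 ey)
  linarith

open scoped Classical in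
/-- Every hull vertex contributes a `5`-hole for each of its disjoint windows, and no `5`-hole is
counted more than `75` times. -/
theorem card_firstLayer_mul_le {P : Finset Plane} (hP : GeneralPosition P) (h3 : 3 ≤ P.card) :
    (firstLayer P).card * ((P.card - 1) / 9) ≤ 75 * (holes P 5).card := by
  have hsub : firstLayer P ⊆ P := Finset.filter_subset _ _
  have hapex : ∀ p ∈ firstLayer P, IsApex P p := fun p hp => isApex_of_mem_firstLayer hP h3 hp
  choose! q hqmem hqlt hqsurj using fun p hp => (hapex p hp).exists_enumeration hP
  set k := (P.card - 1) / 9 with hk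
  have hwin : ∀ p ∈ firstLayer P, ∀ w < k, IsWindow P p fun i => q p (9 * w + i) := by
    intro p hp w hw
    refine ⟨fun i hi => hqmem p hp _ (by omega),
      fun i j hij hj => hqlt p hp _ _ (by omega) (by omega), ?_⟩
    intro z hz h0 h8
    have hzp : z ≠ p := by rintro rfl; simp [turn_self_left] at h0
    obtain ⟨m, hm, rfl⟩ := hqsurj p hp z hz hzp
    have key : ∀ i j, i < P.card - 1 → 0 < turn p (q p j) (q p i) → i < j := by
      intro i j hi h
      rcases lt_trichotomy i j with hlt | rfl | hgt
      · exact hlt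
      · rw [turn_self_right] at h; exact absurd h (lt_irrefl _)
      · have := hqlt p hp j i hgt hi
        rw [turn_swap] at this
        linarith
    have h1 := key _ _ (by omega) h0
    have h2 := key _ _ hm h8
    exact ⟨m - 9 * w, by omega, by congr 1; omega⟩
  have hinj : ∀ p ∈ firstLayer P, ∀ i j, i < P.card - 1 → j < P.card - 1 → q p i = q p j →
      i = j := by
    intro p hp i j hi hj h
    by_contra hij
    rcases Nat.lt_or_gt_of_ne hij with hlt | hlt
    · have := hqlt p hp i j hlt hj
      rw [h, turn_self_right] at this
      exact lt_irrefl _ this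
    · have := hqlt p hp j i hlt hi
      rw [h, turn_self_right] at this
      exact lt_irrefl _ this
  -- The code of a pair (p, window): a hole, a vertex of it in the window, a second vertex, and a
  -- tag telling whether that vertex is p or the pair is supported before or after.
  have hex : ∀ a : Plane × ℕ, a ∈ firstLayer P ×ˢ Finset.range k →
      ∃ c : (_ : Finset Plane) × (Plane × Plane × Fin 3),
        c ∈ (holes P 5).sigma (fun H => H ×ˢ H ×ˢ Finset.univ) ∧
        (∃ i < 9, c.2.1 = q a.1 (9 * a.2 + i)) ∧
        ((c.2.2.2 = 0 ∧ c.2.2.1 = a.1) ∨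
          (c.2.2.2 = 1 ∧ SupportedBefore P a.1 c.2.1 c.2.2.1) ∨
          (c.2.2.2 = 2 ∧ SupportedAfter P a.1 c.2.1 c.2.2.1)) := by
    rintro ⟨p, w⟩ ha
    simp only [Finset.mem_product, Finset.mem_range] at ha
    obtain ⟨H, hH, i, hi, hiH, h | ⟨b, hb, h | h⟩⟩ :=
      (hwin p ha.1 w ha.2).exists_hole hP (hapex p ha.1)
    · exact ⟨⟨H, _, p, 0⟩, by simp [hH, hiH, h], ⟨i, hi, rfl⟩, Or.inl ⟨rfl, rfl⟩⟩
    · exact ⟨⟨H, _, b, 1⟩, by simp [hH, hiH, hb], ⟨i, hi, rfl⟩, Or.inr (Or.inl ⟨rfl, h⟩)⟩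
    · exact ⟨⟨H, _, b, 2⟩, by simp [hH, hiH, hb], ⟨i, hi, rfl⟩, Or.inr (Or.inr ⟨rfl, h⟩)⟩
  choose! F hFmem hFwin hFtag using hex
  have hholes : ∀ H ∈ holes P 5, H ⊆ P ∧ H.card = 5 := by
    intro H hH
    simp only [holes, Finset.mem_filter] at hH
    exact ⟨hH.2.subset, hH.2.card_eq⟩
  have hFinj : Set.InjOn F (firstLayer P ×ˢ Finset.range k : Finset (Plane × ℕ)) := by
    rintro ⟨p, w⟩ ha ⟨p', w'⟩ ha' hF
    have ha := Finset.mem_coe.1 ha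
    have ha' := Finset.mem_coe.1 ha'
    obtain ⟨i, hi, hx⟩ := hFwin _ ha
    obtain ⟨i', hi', hx'⟩ := hFwin _ ha'
    have tag := hFtag _ ha
    have tag' := hFtag _ ha'
    have hmem := hFmem _ ha
    rw [← hF] at hx' tag'
    generalize F (p, w) = c at *
    obtain ⟨H, x, y, t⟩ := c
    simp only [Finset.mem_sigma, Finset.mem_product, Finset.mem_range] at *
    have hxP := (hholes H hmem.1).1 hmem.2.1
    have hyP := (hholes H hmem.1).1 hmem.2.2.1
    have hp : p = p' := by
      rcases tag with ⟨rfl, h⟩ | ⟨rfl, h⟩ | ⟨rfl, h⟩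
      · rcases tag' with ⟨-, h'⟩ | ⟨h', -⟩ | ⟨h', -⟩
        · exact h.symm.trans h'
        · exact absurd h' (by decide)
        · exact absurd h' (by decide)
      · rcases tag' with ⟨h', -⟩ | ⟨-, h'⟩ | ⟨h', -⟩
        · exact absurd h' (by decide)
        · exact h.unique hP (hsub ha.1) (hsub ha'.1) hxP h'
        · exact absurd h' (by decide)
      · rcases tag' with ⟨h', -⟩ | ⟨h', -⟩ | ⟨-, h'⟩
        · exact absurd h' (by decide)
        · exact absurd h' (by decide)
        · exact h.unique hP (hsub ha.1) (hsub ha'.1) hyP h'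
    subst hp
    -- With p known, the first vertex has a unique position 9w + i with i < 9, which determines w.
    have := hinj p ha.1 _ _ (by omega) (by omega) (hx.symm.trans hx')
    have : w = w' := by omega
    rw [this]
  have hcard := Finset.card_le_card_of_injOn F hFmem hFinj
  rw [Finset.card_product, Finset.card_range, Finset.card_sigma] at hcard
  refine hcard.trans ?_
  rw [Finset.sum_congr rfl (g := fun _ => 75), Finset.sum_const, smul_eq_mul, mul_comm]
  intro H hH
  simp [(hholes H hH).2]

/-- There are quadratically many `5`-holes in terms of the first layer and the whole set. -/
theorem five_holes_lower_bound {P : Finset Plane} (hP : GeneralPosition P) :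
    (1 / 2000 : ℝ) * (((firstLayer P).card : ℝ) * (P.card : ℝ)) - (1 / 2000 : ℝ)⁻¹ ≤
      ((holes P 5).card : ℝ) := by
  have hle : (firstLayer P).card ≤ P.card := by
    classical exact Finset.card_le_card (Finset.filter_subset _ _)
  have hle' : ((firstLayer P).card : ℝ) ≤ P.card := by exact_mod_cast hle
  have h0 : (0 : ℝ) ≤ (firstLayer P).card := by positivity
  have h0' : (0 : ℝ) ≤ (holes P 5).card := by positivity
  norm_num
  -- Below 18 points the left side is negative; from 18 on, rounding down in the number of windows
  -- costs at most a factor 2.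
  rcases lt_or_ge P.card 18 with h | h
  · have h' : (P.card : ℝ) ≤ 18 := by exact_mod_cast h.le
    nlinarith
  · have key := card_firstLayer_mul_le hP (by omega)
    have hk : P.card ≤ 18 * ((P.card - 1) / 9) := by omega
    have h1 : (firstLayer P).card * P.card ≤ 1350 * (holes P 5).card := by
      calc (firstLayer P).card * P.card ≤ (firstLayer P).card * (18 * ((P.card - 1) / 9)) := by
            gcongr
        _ = 18 * ((firstLayer P).card * ((P.card - 1) / 9)) := by ring
        _ ≤ 18 * (75 * (holes P 5).card) := by gcongr
        _ = 1350 * (holes P 5).card := by ring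
    have h2 : ((firstLayer P).card : ℝ) * P.card ≤ 1350 * (holes P 5).card := by exact_mod_cast h1
    linarith

/-! ### Peeling layers -/

theorem afterLayers_subset (P : Finset Plane) {j k : ℕ} (hjk : j ≤ k) :
    afterLayers P k ⊆ afterLayers P j := by
  classical
  induction k, hjk using Nat.le_induction with
  | base => exact subset_rfl
  | succ k _ ih =>
    rw [afterLayers]
    exact Finset.sdiff_subset.trans ih

/-- Holes of what remains after removing layers are holes of the whole set. -/
theorem holes_afterLayers_subset (P : Finset Plane) (k m : ℕ) :
    holes (afterLayers P k) m ⊆ holes P m := by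
  classical
  have hsub : afterLayers P k ⊆ P := afterLayers_subset P k.zero_le
  intro H hH
  simp only [holes, Finset.mem_filter, Finset.mem_powerset] at hH ⊢
  obtain ⟨hHk, hH⟩ := hH
  refine ⟨hHk.trans hsub, hHk.trans hsub, hH.card_eq, hH.convexIndependent, ?_⟩
  -- Layers are put back one at a time. A point of a layer is on the boundary of a hull that
  -- contains the hull of `H`, so it is not interior to the latter.
  have step : ∀ j ≤ k, ∀ p ∈ afterLayers P (k - j),
      p ∉ interior (convexHull ℝ (H : Set Plane)) := by
    intro j
    induction j with
    | zero => exact fun _ => hH.empty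
    | succ j ih =>
      intro hj p hp hpi
      have hk : k - j = (k - (j + 1)) + 1 := by omega
      by_cases hl : p ∈ firstLayer (afterLayers P (k - (j + 1)))
      · simp only [firstLayer, Finset.mem_filter] at hl
        refine hl.2.2 (interior_mono (convexHull_mono ?_) hpi)
        exact_mod_cast hHk.trans (afterLayers_subset P (by omega))
      · refine ih (by omega) p ?_ hpi
        rw [hk, afterLayers]
        exact Finset.mem_sdiff.2 ⟨hp, hl⟩
  simpa [afterLayers] using step k le_rfl

/-- Some layer is large, at a time when many points remain. -/
theorem exists_large_layer (P : Finset Plane) (hL : numLayers P ≠ 0) :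
    ∃ k, (P.card : ℝ) ^ 2 / numLayers P ≤
      2 * (((firstLayer (afterLayers P k)).card : ℝ) * (afterLayers P k).card) := by
  classical
  by_contra! hlt
  have hL' : (0 : ℝ) < numLayers P := by positivity
  have hcard : ∀ k, ((afterLayers P (k + 1)).card : ℝ) =
      (afterLayers P k).card - (firstLayer (afterLayers P k)).card := by
    intro k
    have hs : firstLayer (afterLayers P k) ⊆ afterLayers P k := Finset.filter_subset _ _
    rw [afterLayers, Finset.cast_card_sdiff hs]
  have hend : ((afterLayers P (numLayers P)).card : ℝ) = 0 := by
    have : afterLayers P (numLayers P) = ∅ := Nat.find_spec (exists_afterLayers_eq_empty P)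
    simp [this]
  -- If m points remain and the layer has ℓ of them, then m² − (m − ℓ)² ≤ 2ℓm. Summed over all
  -- layers, the left sides telescope to n².
  have hstep : ∀ k, ((afterLayers P k).card : ℝ) ^ 2 - ((afterLayers P (k + 1)).card : ℝ) ^ 2 ≤
      2 * (((firstLayer (afterLayers P k)).card : ℝ) * (afterLayers P k).card) := by
    intro k
    rw [hcard]
    nlinarith [sq_nonneg ((firstLayer (afterLayers P k)).card : ℝ)]
  have hsum : ∑ k ∈ Finset.range (numLayers P), (((afterLayers P k).card : ℝ) ^ 2 -
      ((afterLayers P (k + 1)).card : ℝ) ^ 2) <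
      ∑ _k ∈ Finset.range (numLayers P), (P.card : ℝ) ^ 2 / numLayers P :=
    Finset.sum_lt_sum_of_nonempty (Finset.nonempty_range_iff.2 hL)
      fun k _ => (hstep k).trans_lt (hlt k)
  rw [Finset.sum_range_sub', hend, Finset.sum_const, Finset.card_range, nsmul_eq_mul,
    mul_div_cancel₀ _ hL'.ne'] at hsum
  simp [afterLayers] at hsum

theorem theorem2p1 :
    (∃ c : ℝ, 0 < c ∧ ∀ P : Finset Plane, GeneralPosition P →
      c * ((P.card : ℝ) ^ 2 / (numLayers P : ℝ)) - c⁻¹ ≤ ((holes P 5).card : ℝ)) ∧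
    (∃ c : ℝ, 0 < c ∧ ∀ P : Finset Plane, GeneralPosition P →
      c * (((firstLayer P).card : ℝ) * (P.card : ℝ)) - c⁻¹ ≤ ((holes P 5).card : ℝ)) := by
  -- The first constant is half the second, to absorb the factor 2 in `exists_large_layer`.
  refine ⟨⟨1 / 4000, by norm_num, ?_⟩, 1 / 2000, by norm_num, fun P => five_holes_lower_bound⟩
  intro P hP
  -- Zero layers means that `P` is empty; the quotient is then 0 by convention.
  rcases eq_or_ne (numLayers P) 0 with h0 | h0
  · have : (0 : ℝ) ≤ (holes P 5).card := by positivity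
    simp only [h0, Nat.cast_zero, div_zero, mul_zero]
    norm_num
    linarith
  · obtain ⟨k, hk⟩ := exists_large_layer P h0
    have h1 := five_holes_lower_bound (hP.mono (afterLayers_subset P k.zero_le))
    have h2 : ((holes (afterLayers P k) 5).card : ℝ) ≤ (holes P 5).card := by
      exact_mod_cast Finset.card_le_card (holes_afterLayers_subset P k 5)
    norm_num at h1 ⊢
    linarith
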